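/- Let $f=J^{-1}\sum_{j=1}^J f_j+h$ on $\mathbb R^{m}\times\mathbb R^{n}$ with variable $x=(x_1,x_2)$, where all $f_j,h$ are twice continuously differentiable, $\nabla f_j$ is $L_j$-Lipschitz (not all $L_j$ equal to $0$; $L_j>0$ for at least one $j$), $\nabla h$ is $L_h$-Lipschitz and $\nabla f$ is $L$-Lipschitz, in the Euclidean norm, and where $\nabla^2 f(x)\succeq\mu I$ for all $x$, with $\mu>0$. Let $0<\underline\lambda\le\mu$. For a symmetric matrix $H$ let $\operatorname{mod}(H)$ have the eigenvectors of $H$, with every eigenvalue $s$ replaced by $\max\{|s|,\underline\lambda\}$. The basic asynchronous algorithm with step sizes $\alpha_t$ and stalenesses $\tau^1_{t,j},\tau^{21}_{t,j},\tau^{22}_{t,j}\in\{0,\dots,t\}$ starts at an arbitrary $(x_1^0,x_2^0)$ and produces, for $t=0,1,2,\dots$, $$x_1^{t+1}\in\arg\min_{x_1}\Big\{J^{-1}\sum_{j=1}^J \big[f_j(x_1,x_2^{t-\tau^1_{t,j}})+h(x_1,x_2^t)\big]\Big\},\qquad x_2^{t+1}=x_2^t-\alpha_t\,\widetilde H_t^{-1}\widetilde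 G_t,$$ $$\widetilde G_t=J^{-1}\sum_{j=1}^J\frac{\partial f_j}{\partial x_2}(x_1^{t+1-\tau^{21}_{t,j}},x_2^{t-\tau^{22}_{t,j}})+\frac{\partial h}{\partial x_2}(x_1^{t+1},x_2^t),$$ $$\widetilde H_t=\operatorname{mod}\Big[J^{-1}\sum_{j=1}^J\frac{\partial^2 f_j}{\partial x_2^2}(x_1^{t+1-\tau^{21}_{t,j}},x_2^{t-\tau^{22}_{t,j}})+\frac{\partial^2 h}{\partial x_2^2}(x_1^{t+1},x_2^t)\Big].$$ Suppose that for all $t,j$ the three stalenesses are at most $\tau$, and that for all $t$ each of the averages $J^{-1}\sum_j\tau^1_{t,j}$, $J^{-1}\sum_j\tau^{21}_{t,j}$, $J^{-1}\sum_j\tau^{22}_{t,j}$ is at most $\overline\tau$. Put $\kappa=L/\mu$, $\overline L=J^{-1}\sum_jL_j$, $L^{\mathrm{msq}}=J^{-1}\sum_jL_j^2$, $\overline\lambda=\overline L+L_h$ and $$C_0=\mu\min\Big\{\frac{2}{\kappa L(18\kappa^2+1)},\frac1{3\overline\lambda}\Big\},$$ $$C_1=4\mu^{-1}\underline\lambda^{-3}L^{\mathrm{msq}}(L^{\mathrm{msq}}+L_h^2)\big[1+6\mu^{-2}\big(2L^{\mathrm{msq}}+(L_h+\overline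 L)^2\big)\big],$$ $$C_2=4\big(L\overline\lambda^{-1}+1\big)\underline\lambda^{-2}\mu^{-3}L\,L^{\mathrm{msq}}(L^{\mathrm{msq}}+L_h^2),$$ $$A_0=\min\Big\{\frac{C_0}{C_2+\sqrt{C_1C_0}},\frac{\underline\lambda}{L}\Big\},\qquad A_1=C_0^{-1}A_0^{-1}.$$ Let $0<\beta<1$ and $\alpha_t=\beta A_0(\overline\tau+1)^{-1}(\tau+1)^{-1}$ for all $t$. Then every sequence produced by the algorithm satisfies, with $V_t=f(x_1^t,x_2^t)-\min f$, $$V_t\le\Big[1-\frac{(1-\beta)\beta}{A_1+8\beta^2}(\overline\tau+1)^{-1}(\tau+1)^{-1}\Big]^tV_0\qquad\text{for all }t\ge0.$$ -/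

import Mathlib

namespace AsyncBlock

noncomputable section

/-- Euclidean space of dimension `n`. -/
abbrev Vec (n : ℕ) : Type := EuclideanSpace ℝ (Fin n)

/-- The space of `x = (x₁, x₂)` with the Euclidean norm of the concatenated vector. -/
abbrev Blocks (m n : ℕ) : Type := WithLp 2 (Vec m × Vec n)

/-- The point `(x₁, x₂)`. -/
def pt {m n : ℕ} (x₁ : Vec m) (x₂ : Vec n) : Blocks m n := WithLp.toLp 2 (x₁, x₂)

/-- The average over the `J` workers. -/
def avg {J : ℕ} {E : Type*} [AddCommGroup E] [Module ℝ E] (a : Fin J → E) : E :=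
  (J : ℝ)⁻¹ • ∑ j, a j

/-- The global objective `f = J⁻¹ ∑ⱼ fⱼ + h`. -/
def objective {J m n : ℕ} (f : Fin J → Blocks m n → ℝ) (h : Blocks m n → ℝ) :
    Blocks m n → ℝ :=
  fun x => avg (fun j => f j x) + h x

/-- The gradient of `g` is Lipschitz continuous with constant `L`. -/
def GradLipschitz {m n : ℕ} (g : Blocks m n → ℝ) (L : ℝ) : Prop :=
  ∀ x y, ‖gradient g x - gradient g y‖ ≤ L * ‖x - y‖

/-- The Hessian of `g` is at least `μ` times the identity everywhere. -/
def HessianGE {m n : ℕ} (g : Blocks m n → ℝ) (μ : ℝ) : Prop :=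
  ∀ x v, μ * ‖v‖ ^ 2 ≤ inner ℝ v (fderiv ℝ (gradient g) x v)

/-- The partial gradient `∂g/∂x₂` at `(x₁, x₂)`. -/
def grad₂ {m n : ℕ} (g : Blocks m n → ℝ) (x₁ : Vec m) (x₂ : Vec n) : Vec n :=
  gradient (fun y => g (pt x₁ y)) x₂

/-- The matrix of the partial Hessian `∂²g/∂x₂²` at `(x₁, x₂)`. -/
def hess₂ {m n : ℕ} (g : Blocks m n → ℝ) (x₁ : Vec m) (x₂ : Vec n) :
    Matrix (Fin n) (Fin n) ℝ :=
  (Matrix.toEuclideanCLM (n := Fin n) (𝕜 := ℝ)).symm (fderiv ℝ (grad₂ g x₁) x₂)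

/-- The modification of a symmetric matrix with threshold `lam`: each eigenvalue `s` is
replaced by `max |s| lam`, the eigenvectors are kept. -/
def modHess {n : ℕ} (lam : ℝ) (H : Matrix (Fin n) (Fin n) ℝ) : Matrix (Fin n) (Fin n) ℝ :=
  cfc (fun s : ℝ => max |s| lam) H

/-- The stale gradient at iteration `t`. -/
def staleGrad {J m n : ℕ} (f : Fin J → Blocks m n → ℝ) (h : Blocks m n → ℝ)
    (τ₂₁ τ₂₂ : ℕ → Fin J → ℕ) (x₁ : ℕ → Vec m) (x₂ : ℕ → Vec n) (t : ℕ) : Vec n :=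
  avg (fun j => grad₂ (f j) (x₁ (t + 1 - τ₂₁ t j)) (x₂ (t - τ₂₂ t j)))
    + grad₂ h (x₁ (t + 1)) (x₂ t)

/-- The stale modified Hessian at iteration `t`. -/
def staleHess {J m n : ℕ} (lam : ℝ) (f : Fin J → Blocks m n → ℝ) (h : Blocks m n → ℝ)
    (τ₂₁ τ₂₂ : ℕ → Fin J → ℕ) (x₁ : ℕ → Vec m) (x₂ : ℕ → Vec n) (t : ℕ) :
    Matrix (Fin n) (Fin n) ℝ :=
  modHess lam (avg (fun j => hess₂ (f j) (x₁ (t + 1 - τ₂₁ t j)) (x₂ (t - τ₂₂ t j)))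
    + hess₂ h (x₁ (t + 1)) (x₂ t))

/-- `(x₁, x₂)` is a run of the basic asynchronous algorithm with step sizes `α`, threshold
`lam` and stalenesses `τ₁, τ₂₁, τ₂₂`. Information used at iteration `t` was produced at one of
the iterations `0, …, t`; in particular the natural-number subtractions do not truncate. -/
structure IsRun {J m n : ℕ} (lam : ℝ) (f : Fin J → Blocks m n → ℝ) (h : Blocks m n → ℝ)
    (τ₁ τ₂₁ τ₂₂ : ℕ → Fin J → ℕ) (α : ℕ → ℝ) (x₁ : ℕ → Vec m) (x₂ : ℕ → Vec n) : Prop where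
  stale₁_le : ∀ t j, τ₁ t j ≤ t
  stale₂₁_le : ∀ t j, τ₂₁ t j ≤ t
  stale₂₂_le : ∀ t j, τ₂₂ t j ≤ t
  update₁ : ∀ t, IsMinOn
    (fun y => avg (fun j => f j (pt y (x₂ (t - τ₁ t j))) + h (pt y (x₂ t))))
    Set.univ (x₁ (t + 1))
  update₂ : ∀ t, x₂ (t + 1) = x₂ t - α t •
    Matrix.toEuclideanCLM (n := Fin n) (𝕜 := ℝ) (staleHess lam f h τ₂₁ τ₂₂ x₁ x₂ t)⁻¹
      (staleGrad f h τ₂₁ τ₂₂ x₁ x₂ t)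

/-- The stalenesses are at most `τ`, and their averages over the workers at most `τbar`. -/
def StalenessBound {J : ℕ} (τ₁ τ₂₁ τ₂₂ : ℕ → Fin J → ℕ) (τ : ℕ) (τbar : ℝ) : Prop :=
  (∀ t j, τ₁ t j ≤ τ ∧ τ₂₁ t j ≤ τ ∧ τ₂₂ t j ≤ τ) ∧
  (∀ t, avg (fun j => (τ₁ t j : ℝ)) ≤ τbar ∧ avg (fun j => (τ₂₁ t j : ℝ)) ≤ τbar ∧
    avg (fun j => (τ₂₂ t j : ℝ)) ≤ τbar)

/-- The optimality gap `f(x₁ᵗ, x₂ᵗ) - min f`. -/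
def gap {J m n : ℕ} (f : Fin J → Blocks m n → ℝ) (h : Blocks m n → ℝ)
    (x₁ : ℕ → Vec m) (x₂ : ℕ → Vec n) (t : ℕ) : ℝ :=
  objective f h (pt (x₁ t) (x₂ t)) - ⨅ x, objective f h x

/-! The constants. Here `Lj` and `Lh` are the gradient-Lipschitz constants of the local
functions and of the common term, `L` the one of the objective, `μ` the strong convexity
constant and `lam` the eigenvalue threshold. -/

/-- The mean square of the local Lipschitz constants. -/
def Lmsq {J : ℕ} (Lj : Fin J → ℝ) : ℝ := avg (fun j => Lj j ^ 2)

/-- The upper bound on the eigenvalues of every stale modified Hessian. -/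
def lamBar {J : ℕ} (Lj : Fin J → ℝ) (Lh : ℝ) : ℝ := avg Lj + Lh

/-- The coefficient of the descent term. -/
def C₀ {J : ℕ} (Lj : Fin J → ℝ) (Lh L μ : ℝ) : ℝ :=
  μ * min (2 * (L / μ * L * (18 * (L / μ) ^ 2 + 1))⁻¹) (1 / 3 * (lamBar Lj Lh)⁻¹)

/-- The coefficient of the cubic staleness term. -/
def C₁ {J : ℕ} (Lj : Fin J → ℝ) (Lh μ lam : ℝ) : ℝ :=
  4 * μ⁻¹ * (lam ^ 3)⁻¹ * Lmsq Lj * (Lmsq Lj + Lh ^ 2) *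
    (1 + 6 * (μ ^ 2)⁻¹ * (2 * Lmsq Lj + (Lh + avg Lj) ^ 2))

/-- The coefficient of the quadratic staleness term. -/
def C₂ {J : ℕ} (Lj : Fin J → ℝ) (Lh L μ lam : ℝ) : ℝ :=
  4 * (L * (lamBar Lj Lh)⁻¹ + 1) * (lam ^ 2)⁻¹ * (μ ^ 3)⁻¹ * L * Lmsq Lj *
    (Lmsq Lj + Lh ^ 2)

/-- The step size constant; `lam / L` is the largest step size allowed without staleness. -/
def A₀ {J : ℕ} (Lj : Fin J → ℝ) (Lh L μ lam : ℝ) : ℝ :=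
  min (C₀ Lj Lh L μ *
      (C₂ Lj Lh L μ lam + √(C₁ Lj Lh μ lam * C₀ Lj Lh L μ))⁻¹) (lam / L)

/-- The rate constant. -/
def A₁ {J : ℕ} (Lj : Fin J → ℝ) (Lh L μ lam : ℝ) : ℝ :=
  (C₀ Lj Lh L μ)⁻¹ * (A₀ Lj Lh L μ lam)⁻¹

end

end AsyncBlock

/-! Without staleness each iteration is an exact minimization in the first block followed by a
preconditioned gradient step in the second, and strong convexity makes the gap `V` contract.
Staleness adds two errors: the residual `u`, the first-block gradient of the objective at `(x₁
(t+1), x₂ t)`, which an exact minimization would make zero, and the error `e` of the stale gradient.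
With `b = lamBar Lj Lh`, `inexact_block_step` gives V(t+1) ≤ (1 - αμ/b) V(t) + ‖u‖²/(2μ) + α‖e‖²/(2
lam).

Both errors are controlled by a bound `D` on the recent moves of `x₂`. For `u`, only the shift of
`x₂` over the delay matters; for `e`, the shift of `x₁` matters too, and strong convexity in the
first block reduces it to residuals and shifts of `x₂`. Cauchy–Schwarz over the workers, with σ² ≤
τσ for each staleness σ, turns the delays into the factor τ·τbar. In turn, if `M` bounds `V` on a
recent window, the iterates read there lie within √(4M/μ) of the minimizer, where the gradient
vanishes, so `D` is O(α√M). Hence the errors total at most (C₁α³ + C₂α²)·τ·τbar·M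
(`staleness_error_le`).

`A₀` is chosen so that this is at most βδM with δ = C₀α ≤ αμ/b. There remains the delayed recursion
V(t+1) ≤ (1 - δ)V(t) + βδ·max V over the last 3τ iterations, which `rate_inequality` and
`delayed_contraction` turn into a geometric rate. -/

namespace AsyncBlock

/-! ### Lipschitz gradients and strong convexity in a Hilbert space. -/

section Analysis

variable {E : Type*} [NormedAddCommGroup E] [InnerProductSpace ℝ E] [CompleteSpace E]

theorem hasDerivAt_comp_segment {g : E → ℝ} (hg : Differentiable ℝ g) (x v : E) (s : ℝ) :
    HasDerivAt (fun s : ℝ => g (x + s • v)) (inner ℝ (gradient g (x + s • v)) v) s := by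
  have h1 : HasDerivAt (fun s : ℝ => x + s • v) v s := by
    simpa using ((hasDerivAt_id s).smul_const v).const_add x
  have h2 := (hg (x + s • v)).hasGradientAt.hasFDerivAt.comp_hasDerivAt s h1
  rwa [InnerProductSpace.toDual_apply_apply] at h2

/-- The difference of `g` along the segment and the quadratic `s * ⟪∇g x, v⟫ + c / 2 * s ^ 2` has
nonnegative derivative on (0, 1); comparing its endpoint values replaces a Taylor formula with
integral remainder. -/
theorem quadratic_lower_of_gradient {g : E → ℝ} (hg : Differentiable ℝ g) {x v : E} {c : ℝ}
    (h : ∀ s ∈ Set.Ioo (0 : ℝ) 1, c * s ≤ inner ℝ (gradient g (x + s • v) - gradient g x) v) :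
    g x + inner ℝ (gradient g x) v + c / 2 ≤ g (x + v) := by
  have hd : ∀ s : ℝ, HasDerivAt
      (fun s : ℝ => g (x + s • v) - (s * inner ℝ (gradient g x) v + c / 2 * s ^ 2))
      (inner ℝ (gradient g (x + s • v)) v - (inner ℝ (gradient g x) v + c * s)) s := by
    intro s
    have h1 := hasDerivAt_comp_segment hg x v s
    have h2 := ((hasDerivAt_id s).mul_const (inner ℝ (gradient g x) v)).add
      ((hasDerivAt_pow 2 s).const_mul (c / 2))
    refine (h1.sub h2).congr_deriv ?_
    norm_num
    ring
  have hm := monotoneOn_of_deriv_nonneg (convex_Icc (0 : ℝ) 1)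
    (fun s _ => (hd s).continuousAt.continuousWithinAt)
    (fun s _ => (hd s).differentiableAt.differentiableWithinAt)
    (fun s hs => by
      rw [interior_Icc] at hs
      rw [(hd s).deriv]
      have := h s hs
      rw [inner_sub_left] at this
      linarith)
  have := hm (by simp) (by simp) (zero_le_one' ℝ)
  simp only [one_smul, zero_smul, add_zero] at this
  linarith

theorem quadratic_upper_of_gradient {g : E → ℝ} (hg : Differentiable ℝ g) {x v : E} {c : ℝ}
    (h : ∀ s ∈ Set.Ioo (0 : ℝ) 1, inner ℝ (gradient g (x + s • v) - gradient g x) v ≤ c * s) :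
    g (x + v) ≤ g x + inner ℝ (gradient g x) v + c / 2 := by
  have hn : ∀ y, gradient (fun z => -g z) y = -gradient g y := fun y => by
    simp [gradient, fderiv_fun_neg]
  have := quadratic_lower_of_gradient (x := x) (v := v) (c := -c) hg.neg
    (fun s hs => by
      have := h s hs
      simp only [Pi.neg_def, hn, inner_sub_left, inner_neg_left] at this ⊢
      linarith)
  simp only [Pi.neg_def, hn, inner_neg_left] at this
  linarith

theorem differentiable_gradient {g : E → ℝ} (hg : ContDiff ℝ 2 g) :
    Differentiable ℝ (gradient g) := by
  have h1 : Differentiable ℝ (fderiv ℝ g) :=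
    (hg.fderiv_right (m := 1) (by norm_num)).differentiable (by norm_num)
  exact ((InnerProductSpace.toDual ℝ E).symm.toContinuousLinearEquiv.differentiable).comp h1

theorem inner_fderiv_gradient {g : E → ℝ} (hg : ContDiff ℝ 2 g) (x v w : E) :
    inner ℝ (fderiv ℝ (gradient g) x v) w = fderiv ℝ (fderiv ℝ g) x v w := by
  have h1 : Differentiable ℝ (fderiv ℝ g) :=
    (hg.fderiv_right (m := 1) (by norm_num)).differentiable (by norm_num)
  have : fderiv ℝ (gradient g) x v =
      (InnerProductSpace.toDual ℝ E).symm (fderiv ℝ (fderiv ℝ g) x v) := by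
    have h2 := ((InnerProductSpace.toDual ℝ E).symm.toContinuousLinearEquiv.hasFDerivAt).comp x
      (h1 x).hasFDerivAt
    have h3 : HasFDerivAt (gradient g) _ x := h2
    rw [h3.fderiv]
    rfl
  rw [this, InnerProductSpace.toDual_symm_apply]

theorem isSelfAdjoint_fderiv_gradient {g : E → ℝ} (hg : ContDiff ℝ 2 g) (x : E) :
    IsSelfAdjoint (fderiv ℝ (gradient g) x) := by
  rw [ContinuousLinearMap.isSelfAdjoint_iff_isSymmetric]
  intro v w
  simp only [ContinuousLinearMap.coe_coe]
  rw [real_inner_comm _ v, inner_fderiv_gradient hg, inner_fderiv_gradient hg]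
  exact (hg.contDiffAt.isSymmSndFDerivAt (by simp)).eq v w

theorem inner_gradient_sub_ge {g : E → ℝ} (hg : ContDiff ℝ 2 g) {μ : ℝ}
    (hμ : ∀ x v, μ * ‖v‖ ^ 2 ≤ inner ℝ v (fderiv ℝ (gradient g) x v)) (x v : E) :
    μ * ‖v‖ ^ 2 ≤ inner ℝ (gradient g (x + v) - gradient g x) v := by
  have hd : ∀ s : ℝ, HasDerivAt
      (fun s : ℝ => inner ℝ v (gradient g (x + s • v)) - s * (μ * ‖v‖ ^ 2))
      (inner ℝ v (fderiv ℝ (gradient g) (x + s • v) v) - μ * ‖v‖ ^ 2) s := by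
    intro s
    have h1 : HasDerivAt (fun s : ℝ => x + s • v) v s := by
      simpa using ((hasDerivAt_id s).smul_const v).const_add x
    have h2 := (differentiable_gradient hg (x + s • v)).hasFDerivAt.comp_hasDerivAt s h1
    have h3 := ((innerSL ℝ v).hasFDerivAt.comp_hasDerivAt s h2).sub
      ((hasDerivAt_id s).mul_const (μ * ‖v‖ ^ 2))
    rw [one_mul] at h3
    exact h3
  have hm : Monotone (fun s : ℝ => inner ℝ v (gradient g (x + s • v)) - s * (μ * ‖v‖ ^ 2)) :=
    monotone_of_deriv_nonneg (fun s => (hd s).differentiableAt)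
      (fun s => by rw [(hd s).deriv]; linarith [hμ (x + s • v) v])
  have := hm (zero_le_one' ℝ)
  simp only [one_smul, zero_smul, add_zero] at this
  rw [inner_sub_left, real_inner_comm, real_inner_comm v (gradient g x)]
  linarith

theorem strongConvex_lower {g : E → ℝ} (hg : ContDiff ℝ 2 g) {μ : ℝ}
    (hμ : ∀ x v, μ * ‖v‖ ^ 2 ≤ inner ℝ v (fderiv ℝ (gradient g) x v)) (x v : E) :
    g x + inner ℝ (gradient g x) v + μ / 2 * ‖v‖ ^ 2 ≤ g (x + v) := by
  have := quadratic_lower_of_gradient (x := x) (v := v) (c := μ * ‖v‖ ^ 2)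
    (hg.differentiable (by norm_num)) (fun s hs => by
      have := inner_gradient_sub_ge hg hμ x (s • v)
      rw [norm_smul, inner_smul_right, Real.norm_eq_abs, mul_pow, sq_abs] at this
      have h0 := hs.1
      nlinarith)
  linarith

theorem descent_of_lipschitz_gradient {g : E → ℝ} (hg : Differentiable ℝ g) {L : ℝ}
    (hL : ∀ x y, ‖gradient g x - gradient g y‖ ≤ L * ‖x - y‖) (x v : E) :
    g (x + v) ≤ g x + inner ℝ (gradient g x) v + L / 2 * ‖v‖ ^ 2 := by
  have := quadratic_upper_of_gradient (x := x) (v := v) (c := L * ‖v‖ ^ 2) hg (fun s hs => by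
    refine (real_inner_le_norm _ _).trans ?_
    have h := hL (x + s • v) x
    rw [add_sub_cancel_left, norm_smul, Real.norm_eq_abs, abs_of_pos hs.1] at h
    nlinarith [norm_nonneg v])
  linarith

theorem strongConvex_norm_gradient_sub {g : E → ℝ} (hg : ContDiff ℝ 2 g) {μ : ℝ}
    (hμ : ∀ x v, μ * ‖v‖ ^ 2 ≤ inner ℝ v (fderiv ℝ (gradient g) x v)) (x y : E) :
    μ * ‖x - y‖ ≤ ‖gradient g x - gradient g y‖ := by
  have h := inner_gradient_sub_ge hg hμ y (x - y)
  rw [add_sub_cancel] at h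
  have h2 := real_inner_le_norm (gradient g x - gradient g y) (x - y)
  rcases (norm_nonneg (x - y)).eq_or_lt with h0 | h0
  · rw [← h0, mul_zero]; positivity
  · refine le_of_mul_le_mul_right ?_ h0
    linarith

/-- Completing the square in `v`. Applied to the strong convexity lower bound, it yields
Polyak–Łojasiewicz inequalities. -/
theorem sub_sq_div_le_add {a u v m : ℝ} (hm : 0 < m) (h : -(u * v) ≤ a) :
    -(u ^ 2 / (2 * m)) ≤ a + m / 2 * v ^ 2 := by
  have : u ^ 2 / (2 * m) - u * v + m / 2 * v ^ 2 = (u - m * v) ^ 2 / (2 * m) := by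
    field_simp; ring
  have : 0 ≤ (u - m * v) ^ 2 / (2 * m) := by positivity
  linarith

theorem strongConvex_exists_min [FiniteDimensional ℝ E] {g : E → ℝ} (hg : ContDiff ℝ 2 g)
    {μ : ℝ} (hμ0 : 0 < μ)
    (hμ : ∀ x v, μ * ‖v‖ ^ 2 ≤ inner ℝ v (fderiv ℝ (gradient g) x v)) :
    ∃ x, ∀ y, g x ≤ g y := by
  have : ProperSpace E := FiniteDimensional.proper ℝ E
  refine hg.continuous.exists_forall_le ?_
  have hb : ∀ v : E, g 0 - ‖gradient g 0‖ * ‖v‖ + μ / 2 * ‖v‖ ^ 2 ≤ g v := by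
    intro v
    have h := strongConvex_lower hg hμ 0 v
    have h2 := abs_real_inner_le_norm (gradient g 0) v
    rw [zero_add] at h
    linarith [neg_abs_le (inner ℝ (gradient g 0) v)]
  refine Filter.tendsto_atTop_mono hb ?_
  have ht : Filter.Tendsto (fun r : ℝ => g 0 + r * (μ / 2 * r - ‖gradient g 0‖))
      Filter.atTop Filter.atTop := by
    refine Filter.tendsto_atTop_add_const_left _ _ (Filter.tendsto_id.atTop_mul_atTop₀ ?_)
    exact Filter.tendsto_atTop_add_const_right _ _
      (Filter.tendsto_id.const_mul_atTop (half_pos hμ0))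
  refine (ht.comp (tendsto_norm_cocompact_atTop (E := E))).congr (fun v => ?_)
  simp only [Function.comp]
  ring

end Analysis

end AsyncBlock

namespace AsyncBlock

/-! ### Averages over the workers and Cauchy–Schwarz. -/

section Avg

variable {J : ℕ} {E F : Type*}

theorem avg_add [AddCommGroup E] [Module ℝ E] (a b : Fin J → E) :
    avg (fun j => a j + b j) = avg a + avg b := by
  simp [avg, Finset.sum_add_distrib]

theorem avg_sub [AddCommGroup E] [Module ℝ E] (a b : Fin J → E) :
    avg (fun j => a j - b j) = avg a - avg b := by
  simp [avg, Finset.sum_sub_distrib, smul_sub]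

theorem avg_const [AddCommGroup E] [Module ℝ E] (hJ : J ≠ 0) (c : E) :
    avg (fun _ : Fin J => c) = c := by
  rw [avg, Finset.sum_const, Finset.card_univ, Fintype.card_fin, ← Nat.cast_smul_eq_nsmul ℝ,
    inv_smul_smul₀ (Nat.cast_ne_zero.mpr hJ)]

theorem map_avg [AddCommGroup E] [Module ℝ E] [AddCommGroup F] [Module ℝ F] (φ : E →ₗ[ℝ] F)
    (a : Fin J → E) : φ (avg a) = avg (fun j => φ (a j)) := by
  simp [avg]

theorem avg_mul_const (a : Fin J → ℝ) (c : ℝ) : avg (fun j => a j * c) = avg a * c := by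
  simp [avg, Finset.sum_mul, mul_assoc]

theorem avg_mono {a b : Fin J → ℝ} (hab : ∀ j, a j ≤ b j) : avg a ≤ avg b := by
  simp only [avg, smul_eq_mul]
  gcongr
  exact hab _

theorem avg_nonneg {a : Fin J → ℝ} (ha : ∀ j, 0 ≤ a j) : 0 ≤ avg a := by
  simp only [avg, smul_eq_mul]
  exact mul_nonneg (by positivity) (Finset.sum_nonneg fun j _ => ha j)

theorem norm_avg_le [NormedAddCommGroup E] [NormedSpace ℝ E] (a : Fin J → E) :
    ‖avg a‖ ≤ avg (fun j => ‖a j‖) := by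
  simp only [avg, smul_eq_mul, norm_smul, norm_inv, RCLike.norm_natCast]
  gcongr
  exact norm_sum_le _ _

theorem sq_avg_mul_le (a b : Fin J → ℝ) :
    avg (fun j => a j * b j) ^ 2 ≤ avg (fun j => a j ^ 2) * avg (fun j => b j ^ 2) := by
  have h := Finset.sum_mul_sq_le_sq_mul_sq Finset.univ a b
  simp only [avg, smul_eq_mul]
  calc _ = ((J : ℝ)⁻¹) ^ 2 * (∑ j, a j * b j) ^ 2 := by ring
    _ ≤ ((J : ℝ)⁻¹) ^ 2 * ((∑ j, a j ^ 2) * ∑ j, b j ^ 2) := by gcongr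
    _ = _ := by ring

theorem sq_avg_le (hJ : J ≠ 0) (a : Fin J → ℝ) : avg a ^ 2 ≤ avg (fun j => a j ^ 2) := by
  have h := sq_avg_mul_le a (fun _ => 1)
  simpa [avg_const hJ] using h

end Avg

/-! ### Gradients and Hessians in block coordinates. -/

section Gradients

variable {J m n : ℕ}

theorem hasFDerivAt_avg {E F : Type*} [NormedAddCommGroup E] [NormedSpace ℝ E]
    [NormedAddCommGroup F] [NormedSpace ℝ F] {f : Fin J → E → F} {f' : Fin J → E →L[ℝ] F} {x : E}
    (hf : ∀ j, HasFDerivAt (f j) (f' j) x) :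
    HasFDerivAt (fun x => avg (fun j => f j x)) (avg f') x :=
  (HasFDerivAt.fun_sum fun j _ => hf j).const_smul _

theorem gradient_avg_add {E : Type*} [NormedAddCommGroup E] [InnerProductSpace ℝ E]
    [CompleteSpace E] {f : Fin J → E → ℝ} {h : E → ℝ}
    (hf : ∀ j, Differentiable ℝ (f j)) (hh : Differentiable ℝ h) (x : E) :
    gradient (fun x => avg (fun j => f j x) + h x) x =
      avg (fun j => gradient (f j) x) + gradient h x := by
  have h1 : HasFDerivAt (fun x => avg (fun j => f j x)) (avg fun j => fderiv ℝ (f j) x) x :=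
    hasFDerivAt_avg fun j => (hf j x).hasFDerivAt
  have h2 : HasFDerivAt (fun x => avg (fun j => f j x) + h x) _ x := h1.add (hh x).hasFDerivAt
  have h3 := map_avg (InnerProductSpace.toDual ℝ E).symm.toLinearEquiv.toLinearMap
    (fun j => fderiv ℝ (f j) x)
  rw [gradient, h2.fderiv, map_add]
  exact congrArg (· + _) h3

theorem gradient_objective {f : Fin J → Blocks m n → ℝ} {h : Blocks m n → ℝ}
    (hf : ∀ j, Differentiable ℝ (f j)) (hh : Differentiable ℝ h) (x : Blocks m n) :
    gradient (objective f h) x = avg (fun j => gradient (f j) x) + gradient h x :=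
  gradient_avg_add hf hh x

theorem contDiff_objective {f : Fin J → Blocks m n → ℝ} {h : Blocks m n → ℝ} {k : ℕ∞}
    (hf : ∀ j, ContDiff ℝ k (f j)) (hh : ContDiff ℝ k h) :
    ContDiff ℝ k (objective f h) :=
  ((ContDiff.sum fun j _ => hf j).const_smul (J : ℝ)⁻¹).add hh

theorem gradLipschitz_objective {f : Fin J → Blocks m n → ℝ} {h : Blocks m n → ℝ}
    {Lj : Fin J → ℝ} {Lh : ℝ}
    (hf : ∀ j, Differentiable ℝ (f j)) (hh : Differentiable ℝ h)
    (hfL : ∀ j, GradLipschitz (f j) (Lj j)) (hhL : GradLipschitz h Lh) :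
    GradLipschitz (objective f h) (lamBar Lj Lh) := by
  intro x y
  rw [gradient_objective hf hh, gradient_objective hf hh, add_sub_add_comm, ← avg_sub, lamBar,
    add_mul, ← avg_mul_const]
  exact (norm_add_le _ _).trans
    (add_le_add ((norm_avg_le _).trans (avg_mono fun j => hfL j x y)) (hhL x y))

theorem hasFDerivAt_pt_snd (x₁ : Vec m) (x₂ : Vec n) :
    HasFDerivAt (fun y => pt x₁ y)
      ((WithLp.prodContinuousLinearEquiv 2 ℝ (Vec m) (Vec n)).symm.toContinuousLinearMap ∘L
        ContinuousLinearMap.inr ℝ (Vec m) (Vec n)) x₂ :=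
  (WithLp.prodContinuousLinearEquiv 2 ℝ (Vec m) (Vec n)).symm.hasFDerivAt.comp x₂
    (hasFDerivAt_prodMk_right x₁ x₂)

theorem hasFDerivAt_pt_fst (x₁ : Vec m) (x₂ : Vec n) :
    HasFDerivAt (fun y => pt y x₂)
      ((WithLp.prodContinuousLinearEquiv 2 ℝ (Vec m) (Vec n)).symm.toContinuousLinearMap ∘L
        ContinuousLinearMap.inl ℝ (Vec m) (Vec n)) x₁ :=
  (WithLp.prodContinuousLinearEquiv 2 ℝ (Vec m) (Vec n)).symm.hasFDerivAt.comp x₁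
    (hasFDerivAt_prodMk_left x₁ x₂)

theorem contDiff_pt_snd (x₁ : Vec m) {k : WithTop ℕ∞} :
    ContDiff ℝ k (fun y : Vec n => pt x₁ y) :=
  (WithLp.prodContinuousLinearEquiv 2 ℝ (Vec m) (Vec n)).symm.contDiff.comp
    (contDiff_const.prodMk contDiff_id)

@[simp] theorem pt_fst (x₁ : Vec m) (x₂ : Vec n) : (pt x₁ x₂).fst = x₁ := rfl

@[simp] theorem pt_snd (x₁ : Vec m) (x₂ : Vec n) : (pt x₁ x₂).snd = x₂ := rfl

theorem pt_sub (a c : Vec m) (b d : Vec n) : pt a b - pt c d = pt (a - c) (b - d) := rfl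

theorem pt_add (a c : Vec m) (b d : Vec n) : pt a b + pt c d = pt (a + c) (b + d) := rfl

theorem inner_pt_right (x : Blocks m n) (a : Vec m) (b : Vec n) :
    inner ℝ x (pt a b) = inner ℝ x.fst a + inner ℝ x.snd b := rfl

theorem norm_sq_eq_blocks (x : Blocks m n) : ‖x‖ ^ 2 = ‖x.fst‖ ^ 2 + ‖x.snd‖ ^ 2 :=
  WithLp.prod_norm_sq_eq_of_L2 x

theorem norm_pt_zero_right (a : Vec m) : ‖(pt a 0 : Blocks m n)‖ = ‖a‖ := by
  rw [← sq_eq_sq₀ (norm_nonneg _) (norm_nonneg _), norm_sq_eq_blocks]; simp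

theorem norm_pt_zero_left (b : Vec n) : ‖(pt 0 b : Blocks m n)‖ = ‖b‖ := by
  rw [← sq_eq_sq₀ (norm_nonneg _) (norm_nonneg _), norm_sq_eq_blocks]; simp

theorem norm_fst_le (x : Blocks m n) : ‖x.fst‖ ≤ ‖x‖ := by
  rw [← sq_le_sq₀ (norm_nonneg _) (norm_nonneg _), norm_sq_eq_blocks x]
  linarith [sq_nonneg ‖x.snd‖]

theorem norm_snd_le (x : Blocks m n) : ‖x.snd‖ ≤ ‖x‖ := by
  rw [← sq_le_sq₀ (norm_nonneg _) (norm_nonneg _), norm_sq_eq_blocks x]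
  linarith [sq_nonneg ‖x.fst‖]

theorem grad₂_eq {g : Blocks m n → ℝ} (hg : Differentiable ℝ g) (x₁ : Vec m) (x₂ : Vec n) :
    grad₂ g x₁ x₂ = (gradient g (pt x₁ x₂)).snd := by
  refine ext_inner_right ℝ fun w => ?_
  have h1 := ((hg (pt x₁ x₂)).hasGradientAt.hasFDerivAt.comp x₂ (hasFDerivAt_pt_snd x₁ x₂))
  have h2 : fderiv ℝ (fun y => g (pt x₁ y)) x₂ = _ := h1.fderiv
  rw [grad₂, gradient, InnerProductSpace.toDual_symm_apply, h2]
  have h3 := inner_pt_right (gradient g (pt x₁ x₂)) 0 w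
  rw [inner_zero_right, zero_add] at h3
  exact h3

theorem norm_grad₂_sub_le {g : Blocks m n → ℝ} (hg : Differentiable ℝ g) {L : ℝ}
    (hL : GradLipschitz g L) (x₁ : Vec m) (y z : Vec n) :
    ‖grad₂ g x₁ y - grad₂ g x₁ z‖ ≤ L * ‖y - z‖ := by
  rw [grad₂_eq hg, grad₂_eq hg, ← WithLp.sub_snd]
  refine (norm_snd_le _).trans ((hL _ _).trans_eq ?_)
  rw [pt_sub, sub_self, norm_pt_zero_left]

theorem norm_fderiv_grad₂_le {g : Blocks m n → ℝ} (hg : Differentiable ℝ g) {L : ℝ} (hL0 : 0 ≤ L)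
    (hL : GradLipschitz g L) (x₁ : Vec m) (x₂ : Vec n) :
    ‖fderiv ℝ (grad₂ g x₁) x₂‖ ≤ L :=
  norm_fderiv_le_of_lip' ℝ hL0
    (Filter.Eventually.of_forall fun y => norm_grad₂_sub_le hg hL x₁ y x₂)

theorem isSelfAdjoint_fderiv_grad₂ {g : Blocks m n → ℝ} (hg : ContDiff ℝ 2 g)
    (x₁ : Vec m) (x₂ : Vec n) : IsSelfAdjoint (fderiv ℝ (grad₂ g x₁) x₂) :=
  isSelfAdjoint_fderiv_gradient (hg.comp (contDiff_pt_snd x₁)) x₂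

theorem fst_gradient_eq_zero_of_isMinOn {f : Fin J → Blocks m n → ℝ} {h : Blocks m n → ℝ}
    (hJ : J ≠ 0) (hf : ∀ j, Differentiable ℝ (f j)) (hh : Differentiable ℝ h)
    {y : Fin J → Vec n} {x₁ : Vec m} {x₂ : Vec n}
    (hmin : IsMinOn (fun z => avg (fun j => f j (pt z (y j)) + h (pt z x₂))) Set.univ x₁) :
    avg (fun j => (gradient (f j) (pt x₁ (y j))).fst) + (gradient h (pt x₁ x₂)).fst = 0 := by
  refine ext_inner_right ℝ fun w => ?_
  have hd : ∀ (g : Blocks m n → ℝ) (_ : Differentiable ℝ g) (z : Vec n), HasFDerivAt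
      (fun y => g (pt y z)) (innerSL ℝ (gradient g (pt x₁ z)).fst) x₁ := by
    intro g hg z
    have h1 := ((hg (pt x₁ z)).hasGradientAt.hasFDerivAt.comp x₁ (hasFDerivAt_pt_fst x₁ z))
    refine h1.congr_fderiv ?_
    ext v
    have h3 := inner_pt_right (gradient g (pt x₁ z)) v 0
    rw [inner_zero_right, add_zero] at h3
    exact h3
  have h1 := hasFDerivAt_avg fun j => (hd _ (hf j) (y j)).add (hd _ hh x₂)
  have h2 := (hmin.isLocalMin Filter.univ_mem).hasFDerivAt_eq_zero h1
  have h3 := map_avg (innerSL ℝ (E := Vec m)).toLinearMap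
    (fun j => (gradient (f j) (pt x₁ (y j))).fst)
  -- The common term sits inside the average in the update, so extracting it needs at least one
  -- worker.
  rw [avg_add, avg_const hJ] at h2
  have h4 := DFunLike.congr_fun h2 w
  simp only [ContinuousLinearMap.coe_coe] at h3
  rw [← h3] at h4
  simpa [inner_add_left] using h4

end Gradients

end AsyncBlock

/-! ### Spectral bounds for the modified Hessian. -/

namespace AsyncBlock

open scoped MatrixOrder

variable {n : ℕ}

theorem inner_toEuclideanCLM_nonneg {A : Matrix (Fin n) (Fin n) ℝ} (hA : 0 ≤ A) (v : Vec n) :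
    0 ≤ inner ℝ v (Matrix.toEuclideanCLM (n := Fin n) (𝕜 := ℝ) A v) := by
  rw [Matrix.inner_toEuclideanCLM]
  simpa using (Matrix.nonneg_iff_posSemidef.mp hA).dotProduct_mulVec_nonneg v.ofLp

theorem abs_le_of_mem_spectrum {S : Matrix (Fin n) (Fin n) ℝ} {b : ℝ}
    (hb : ‖Matrix.toEuclideanCLM (n := Fin n) (𝕜 := ℝ) S‖ ≤ b) {s : ℝ} (hs : s ∈ spectrum ℝ S) :
    |s| ≤ b := by
  rw [← AlgEquiv.spectrum_eq (Matrix.toEuclideanCLM (n := Fin n) (𝕜 := ℝ))] at hs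
  rcases subsingleton_or_nontrivial (Vec n) with h | h
  · have : Subsingleton (Vec n →L[ℝ] Vec n) := ContinuousLinearMap.uniqueOfLeft.instSubsingleton
    simp at hs
  · exact (spectrum.norm_le_norm_of_mem hs).trans hb

/-- The inverse of the modified Hessian is a symmetric operator with spectrum in
`[b⁻¹, lam⁻¹]`. -/
theorem modHess_inv_bounds {S : Matrix (Fin n) (Fin n) ℝ} {lam b : ℝ} (hlam : 0 < lam)
    (hlb : lam ≤ b) (hS : IsSelfAdjoint S)
    (hb : ‖Matrix.toEuclideanCLM (n := Fin n) (𝕜 := ℝ) S‖ ≤ b) {P : Vec n →L[ℝ] Vec n}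
    (hP : P = Matrix.toEuclideanCLM (n := Fin n) (𝕜 := ℝ) (modHess lam S)⁻¹) :
    (∀ v w, inner ℝ (P v) w = inner ℝ v (P w)) ∧ (∀ v, b⁻¹ * ‖v‖ ^ 2 ≤ inner ℝ v (P v)) ∧
      (∀ v, inner ℝ v (P v) ≤ lam⁻¹ * ‖v‖ ^ 2) ∧
      (∀ v, ‖P v‖ ^ 2 ≤ lam⁻¹ * inner ℝ v (P v)) := by
  have hpos : ∀ s : ℝ, 0 < max |s| lam := fun s => lt_max_of_lt_right hlam
  have hc : Continuous fun s : ℝ => (max |s| lam)⁻¹ :=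
    (continuous_abs.max continuous_const).inv₀ fun s => (hpos s).ne'
  set g : ℝ → ℝ := fun s => (max |s| lam)⁻¹ with hg
  have hcfc : (modHess lam S)⁻¹ = cfc g S := by
    rw [Matrix.nonsing_inv_eq_ringInverse, modHess, ← cfc_inv _ S (fun s _ => (hpos s).ne')]
  rw [hcfc] at hP
  have hgpos : ∀ s, 0 < g s := fun s => inv_pos.mpr (hpos s)
  have hgle : ∀ s, g s ≤ lam⁻¹ := fun s => inv_anti₀ hlam (le_max_right _ _)
  have hsa : IsSelfAdjoint P := by
    rw [hP]
    exact (cfc_predicate g S).map (Matrix.toEuclideanCLM (n := Fin n) (𝕜 := ℝ))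
  have hsym : ∀ v w, inner ℝ (P v) w = inner ℝ v (P w) :=
    ContinuousLinearMap.isSelfAdjoint_iff_isSymmetric.mp hsa
  have hone : ∀ (c : ℝ), Matrix.toEuclideanCLM (n := Fin n) (𝕜 := ℝ) (cfc (fun _ => c) S) =
      c • ContinuousLinearMap.id ℝ (Vec n) := by
    intro c
    rw [cfc_const c S, Algebra.algebraMap_eq_smul_one, map_smul, map_one]
    rfl
  -- With g(s) = 1 / max(|s|, lam), the three bounds are the scalar inequalities b⁻¹ ≤ g, g ≤ lam⁻¹
  -- and g² ≤ lam⁻¹ g on the spectrum, carried over by the functional calculus. The first uses |s| ≤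
  -- b and lam ≤ b.
  refine ⟨hsym, fun v => ?_, fun v => ?_, fun v => ?_⟩
  · have h := inner_toEuclideanCLM_nonneg (A := cfc (fun s => g s - b⁻¹) S)
      (cfc_nonneg fun s hs => sub_nonneg.mpr
        (inv_anti₀ (hpos s) (max_le (abs_le_of_mem_spectrum hb hs) hlb))) v
    rw [cfc_sub g (fun _ => b⁻¹) S hc.continuousOn continuousOn_const, map_sub, hone, ← hP] at h
    simp only [sub_apply, smul_apply,
      ContinuousLinearMap.id_apply, inner_sub_right, inner_smul_right,
      real_inner_self_eq_norm_sq] at h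
    linarith
  · have h := inner_toEuclideanCLM_nonneg (A := cfc (fun s => lam⁻¹ - g s) S)
      (cfc_nonneg fun s hs => sub_nonneg.mpr (hgle s)) v
    rw [cfc_sub (fun _ => lam⁻¹) g S continuousOn_const hc.continuousOn, map_sub, hone, ← hP] at h
    simp only [sub_apply, smul_apply,
      ContinuousLinearMap.id_apply, inner_sub_right, inner_smul_right,
      real_inner_self_eq_norm_sq] at h
    linarith
  · have h := inner_toEuclideanCLM_nonneg (A := cfc (fun s => lam⁻¹ * g s - g s * g s) S)
      (cfc_nonneg fun s hs => sub_nonneg.mpr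
        (mul_le_mul_of_nonneg_right (hgle s) (hgpos s).le)) v
    rw [cfc_sub (fun s => lam⁻¹ * g s) (fun s => g s * g s) S (hc.const_mul _).continuousOn
      (hc.mul hc).continuousOn, cfc_const_mul lam⁻¹ g S hc.continuousOn,
      cfc_mul g g S hc.continuousOn hc.continuousOn, map_sub, map_smul, map_mul, ← hP] at h
    simp only [sub_apply, smul_apply,
      inner_sub_right, inner_smul_right, mul_apply_eq_comp] at h
    rw [← hsym v (P v), real_inner_self_eq_norm_sq] at h
    linarith

theorem norm_le_of_norm_sq_le_inner {P : Vec n →L[ℝ] Vec n} {c : ℝ} (hc : 0 ≤ c)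
    (h : ∀ v, ‖P v‖ ^ 2 ≤ c * inner ℝ v (P v)) (v : Vec n) : ‖P v‖ ≤ c * ‖v‖ := by
  rcases (norm_nonneg (P v)).eq_or_lt with h0 | h0
  · rw [← h0]; positivity
  · refine le_of_mul_le_mul_right ?_ h0
    have := mul_le_mul_of_nonneg_left (real_inner_le_norm v (P v)) hc
    nlinarith [h v]

theorem isSelfAdjoint_avg_hess₂ {J m : ℕ} {f : Fin J → Blocks m n → ℝ} {h : Blocks m n → ℝ}
    (hf : ∀ j, ContDiff ℝ 2 (f j)) (hh : ContDiff ℝ 2 h) (y₁ : Fin J → Vec m)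
    (y₂ : Fin J → Vec n) (z₁ : Vec m) (z₂ : Vec n) :
    IsSelfAdjoint (avg (fun j => hess₂ (f j) (y₁ j) (y₂ j)) + hess₂ h z₁ z₂) := by
  have hs : ∀ g : Blocks m n → ℝ, ContDiff ℝ 2 g → ∀ x₁ x₂, IsSelfAdjoint (hess₂ g x₁ x₂) :=
    fun g hg x₁ x₂ => by
      apply EquivLike.injective (Matrix.toEuclideanCLM (n := Fin n) (𝕜 := ℝ))
      rw [map_star, hess₂, StarAlgEquiv.apply_symm_apply]
      exact isSelfAdjoint_fderiv_grad₂ hg x₁ x₂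
  refine IsSelfAdjoint.add ?_ (hs h hh _ _)
  exact IsSelfAdjoint.smul (IsSelfAdjoint.all _)
    (isSelfAdjoint_sum _ fun j _ => hs _ (hf j) _ _)

theorem norm_avg_hess₂_le {J m : ℕ} {f : Fin J → Blocks m n → ℝ} {h : Blocks m n → ℝ}
    {Lj : Fin J → ℝ} {Lh : ℝ} (hf : ∀ j, Differentiable ℝ (f j)) (hh : Differentiable ℝ h)
    (hLj : ∀ j, 0 ≤ Lj j) (hLh : 0 ≤ Lh)
    (hfL : ∀ j, GradLipschitz (f j) (Lj j)) (hhL : GradLipschitz h Lh) (y₁ : Fin J → Vec m)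
    (y₂ : Fin J → Vec n) (z₁ : Vec m) (z₂ : Vec n) :
    ‖Matrix.toEuclideanCLM (n := Fin n) (𝕜 := ℝ)
      (avg (fun j => hess₂ (f j) (y₁ j) (y₂ j)) + hess₂ h z₁ z₂)‖ ≤ lamBar Lj Lh := by
  have h2 : Matrix.toEuclideanCLM (n := Fin n) (𝕜 := ℝ)
      (avg (fun j => hess₂ (f j) (y₁ j) (y₂ j)) + hess₂ h z₁ z₂) =
      avg (fun j => fderiv ℝ (grad₂ (f j) (y₁ j)) (y₂ j)) + fderiv ℝ (grad₂ h z₁) z₂ := by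
    simp only [avg, map_add, map_smul, map_sum, hess₂, StarAlgEquiv.apply_symm_apply]
  rw [h2]
  exact (norm_add_le _ _).trans (add_le_add ((norm_avg_le _).trans
    (avg_mono fun j => norm_fderiv_grad₂_le (hf j) (hLj j) (hfL j) _ _))
    (norm_fderiv_grad₂_le hh hLh hhL _ _))

end AsyncBlock

/-! ### One inexact step, and displacements over a delay. -/

namespace AsyncBlock

variable {J m n : ℕ}

theorem strongConvex_norm_fst_gradient_sub {F : Blocks m n → ℝ} (hF : ContDiff ℝ 2 F) {μ : ℝ}
    (hconv : HessianGE F μ) (a b : Vec m) (y : Vec n) :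
    μ * ‖a - b‖ ≤ ‖(gradient F (pt a y)).fst - (gradient F (pt b y)).fst‖ := by
  have h := inner_gradient_sub_ge hF hconv (pt b y) (pt (a - b) 0)
  rw [pt_add, add_sub_cancel, add_zero, norm_pt_zero_right, inner_pt_right, inner_zero_right,
    add_zero, WithLp.sub_fst] at h
  have h2 := real_inner_le_norm ((gradient F (pt a y)).fst - (gradient F (pt b y)).fst) (a - b)
  rcases (norm_nonneg (a - b)).eq_or_lt with h0 | h0
  · rw [← h0, mul_zero]; positivity
  · refine le_of_mul_le_mul_right ?_ h0
    linarith

theorem gradient_eq_zero_of_min {F : Blocks m n → ℝ} {xs : Blocks m n}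
    (hmin : ∀ y, F xs ≤ F y) : gradient F xs = 0 := by
  have : fderiv ℝ F xs = 0 :=
    IsLocalMin.fderiv_eq_zero (Filter.Eventually.of_forall hmin)
  rw [gradient, this, map_zero]

theorem norm_sub_min_sq_le {F : Blocks m n → ℝ} (hF : ContDiff ℝ 2 F) {μ : ℝ} (hμ : 0 < μ)
    (hconv : HessianGE F μ) {xs : Blocks m n} (hmin : ∀ y, F xs ≤ F y) (y : Blocks m n) :
    ‖y - xs‖ ^ 2 ≤ 2 / μ * (F y - F xs) := by
  have h := strongConvex_lower hF hconv xs (y - xs)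
  rw [gradient_eq_zero_of_min hmin, inner_zero_left, add_sub_cancel] at h
  rw [div_mul_eq_mul_div, le_div_iff₀ hμ]
  linarith

/-- One step of the second block update with a preconditioner `P` and an inexact gradient `g`. -/
theorem inexact_block_step {F : Blocks m n → ℝ} (hF : ContDiff ℝ 2 F) {L μ lam b α : ℝ}
    (hL0 : 0 ≤ L) (hL : GradLipschitz F L) (hμ : 0 < μ) (hconv : HessianGE F μ)
    {xs : Blocks m n} (hlam : 0 < lam) (hb : 0 < b)
    (hα : 0 ≤ α) (hαL : α * L ≤ lam) (hαb : α * μ ≤ b) {P : Vec n →L[ℝ] Vec n}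
    (hsym : ∀ v w, inner ℝ (P v) w = inner ℝ v (P w))
    (hlow : ∀ v, b⁻¹ * ‖v‖ ^ 2 ≤ inner ℝ v (P v))
    (hup : ∀ v, inner ℝ v (P v) ≤ lam⁻¹ * ‖v‖ ^ 2)
    (hsq : ∀ v, ‖P v‖ ^ 2 ≤ lam⁻¹ * inner ℝ v (P v)) (a₀ a : Vec m) (y g : Vec n) :
    F (pt a (y - α • P g)) - F xs ≤ (1 - α * μ / b) * (F (pt a₀ y) - F xs)
      + ‖(gradient F (pt a y)).fst‖ ^ 2 / (2 * μ)
      + α / (2 * lam) * ‖g - (gradient F (pt a y)).snd‖ ^ 2 := by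
  set u := (gradient F (pt a y)).fst
  set G := (gradient F (pt a y)).snd
  have hdesc := descent_of_lipschitz_gradient (hF.differentiable (by norm_num)) hL (pt a y)
    (pt 0 (-(α • P g)))
  rw [pt_add, add_zero, ← sub_eq_add_neg, inner_pt_right, inner_zero_right, zero_add,
    norm_pt_zero_left, norm_neg, norm_smul, inner_neg_right, inner_smul_right, Real.norm_eq_abs,
    mul_pow, sq_abs] at hdesc
  have hx : F (pt a y) ≤ F (pt a₀ y) + ‖u‖ ^ 2 / (2 * μ) := by
    have h := strongConvex_lower hF hconv (pt a y) (pt (a₀ - a) 0)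
    rw [pt_add, add_sub_cancel, add_zero, norm_pt_zero_right, inner_pt_right, inner_zero_right,
      add_zero] at h
    have h2 := sub_sq_div_le_add (m := μ) hμ
      (neg_le_of_neg_le ((neg_le_abs _).trans (abs_real_inner_le_norm u (a₀ - a))))
    linarith
  have hpl : F (pt a y) - F xs ≤ (‖u‖ ^ 2 + ‖G‖ ^ 2) / (2 * μ) := by
    have h := strongConvex_lower hF hconv (pt a y) (xs - pt a y)
    rw [add_sub_cancel] at h
    have h2 := sub_sq_div_le_add (m := μ) hμ
      (neg_le_of_neg_le ((neg_le_abs _).trans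
        (abs_real_inner_le_norm (gradient F (pt a y)) (xs - pt a y))))
    rw [norm_sq_eq_blocks (gradient F (pt a y))] at h2
    linarith
  -- The left side is ⟪g - G, P (g - G)⟫. This trades the cross term of the descent inequality for
  -- `⟪G, P G⟫`, which gives the decrease, and the gradient error.
  have hpol : inner ℝ g (P g) - 2 * inner ℝ G (P g) + inner ℝ G (P G)
      ≤ lam⁻¹ * ‖g - G‖ ^ 2 := by
    have h := hup (g - G)
    rw [map_sub, inner_sub_left, inner_sub_right, inner_sub_right, ← hsym g G,
      real_inner_comm G (P g)] at h
    linarith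
  -- The restriction `α * L ≤ lam` lets the second-order term be absorbed by half of the first-order
  -- one.
  have hquad : L * (α ^ 2 * ‖P g‖ ^ 2) ≤ α * inner ℝ g (P g) := by
    have hg : 0 ≤ inner ℝ g (P g) := le_trans (by positivity) (hlow g)
    calc L * (α ^ 2 * ‖P g‖ ^ 2) ≤ L * (α ^ 2 * (lam⁻¹ * inner ℝ g (P g))) := by
          gcongr; exact hsq g
      _ = α * ((α * L) * lam⁻¹ * inner ℝ g (P g)) := by ring
      _ ≤ α * (lam * lam⁻¹ * inner ℝ g (P g)) := by gcongr
      _ = α * inner ℝ g (P g) := by rw [mul_inv_cancel₀ hlam.ne', one_mul]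
  have h1 : F (pt a (y - α • P g)) ≤ F (pt a y) - α / 2 * (b⁻¹ * ‖G‖ ^ 2)
      + α / (2 * lam) * ‖g - G‖ ^ 2 := by
    have h2 := mul_le_mul_of_nonneg_left hpol (div_nonneg hα zero_le_two)
    have h3 := mul_le_mul_of_nonneg_left (hlow G) hα
    have h4 : α / (2 * lam) * ‖g - G‖ ^ 2 = α * (lam⁻¹ * ‖g - G‖ ^ 2) / 2 := by
      field_simp
    rw [h4]
    linarith
  have hG : 2 * μ * (F (pt a y) - F xs) - ‖u‖ ^ 2 ≤ ‖G‖ ^ 2 := by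
    rw [le_div_iff₀ (by positivity)] at hpl
    linarith
  have h5 : α / 2 * (b⁻¹ * (2 * μ * (F (pt a y) - F xs) - ‖u‖ ^ 2))
      ≤ α / 2 * (b⁻¹ * ‖G‖ ^ 2) := by gcongr
  have hr : 0 ≤ 1 - α * μ / b := sub_nonneg.mpr ((div_le_one hb).mpr hαb)
  have h6 := mul_le_mul_of_nonneg_left hx hr
  -- The residual enters through both `hx` and `hpl`; the term `α / 2 * (b⁻¹ * ‖u‖ ^ 2)` cancels
  -- against the one in `h8`, leaving exactly `‖u‖ ^ 2 / (2 * μ)`.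
  have h7 : (1 - α * μ / b) * (F (pt a₀ y) + ‖u‖ ^ 2 / (2 * μ)) =
      (1 - α * μ / b) * F (pt a₀ y) + ‖u‖ ^ 2 / (2 * μ) - α / 2 * (b⁻¹ * ‖u‖ ^ 2) := by
    field_simp; ring
  have h8 : α / 2 * (b⁻¹ * (2 * μ * (F (pt a y) - F xs) - ‖u‖ ^ 2)) =
      α * μ / b * (F (pt a y) - F xs) - α / 2 * (b⁻¹ * ‖u‖ ^ 2) := by
    field_simp
  linarith

theorem norm_sub_le_of_step_le {E : Type*} [NormedAddCommGroup E] {x : ℕ → E} {D : ℝ} {a c : ℕ}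
    (hx : ∀ s, a ≤ s → s < c → ‖x (s + 1) - x s‖ ≤ D) (k : ℕ) (hk : k ≤ c) (hak : a ≤ c - k) :
    ‖x c - x (c - k)‖ ≤ k * D := by
  induction k with
  | zero => simp
  | succ k ih =>
    have h1 := ih (by omega) (by omega)
    have h2 := hx (c - (k + 1)) hak (by omega)
    rw [show c - (k + 1) + 1 = c - k by omega] at h2
    have h3 := norm_add_le (x c - x (c - k)) (x (c - k) - x (c - (k + 1)))
    rw [sub_add_sub_cancel] at h3
    push_cast
    linarith

/-- Only one of the two factors of each square is replaced by its maximum, so the step size depends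
on the product of maximal and average staleness, not on the maximum squared. -/
theorem avg_sq_le_of_le {τ : ℕ} {τbar : ℝ} {σ : Fin J → ℕ} (h1 : ∀ j, σ j ≤ τ)
    (h2 : avg (fun j => (σ j : ℝ)) ≤ τbar) : avg (fun j => (σ j : ℝ) ^ 2) ≤ τ * τbar := by
  calc avg (fun j => (σ j : ℝ) ^ 2) ≤ avg (fun j => (σ j : ℝ) * τ) := by
        refine avg_mono fun j => ?_
        rw [sq]
        gcongr
        exact h1 j
    _ = avg (fun j => (σ j : ℝ)) * τ := avg_mul_const _ _
    _ ≤ τbar * τ := by gcongr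
    _ = τ * τbar := mul_comm _ _

theorem norm_avg_gradient_sub_le {E : Type*} [NormedAddCommGroup E] [InnerProductSpace ℝ E]
    [CompleteSpace E] {f : Fin J → E → ℝ} {h : E → ℝ} {Lj : Fin J → ℝ} {Lh : ℝ}
    (hfL : ∀ j x y, ‖gradient (f j) x - gradient (f j) y‖ ≤ Lj j * ‖x - y‖)
    (hhL : ∀ x y, ‖gradient h x - gradient h y‖ ≤ Lh * ‖x - y‖) (z z' : Fin J → E) (w w' : E) :
    ‖(avg (fun j => gradient (f j) (z j)) + gradient h w) -
      (avg (fun j => gradient (f j) (z' j)) + gradient h w')‖ ≤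
      avg (fun j => Lj j * ‖z j - z' j‖) + Lh * ‖w - w'‖ := by
  rw [add_sub_add_comm, ← avg_sub]
  exact (norm_add_le _ _).trans
    (add_le_add ((norm_avg_le _).trans (avg_mono fun j => hfL j _ _)) (hhL _ _))

theorem fst_avg_add (z : Fin J → Blocks m n) (w : Blocks m n) :
    (avg z + w).fst = avg (fun j => (z j).fst) + w.fst := by
  rw [WithLp.add_fst]
  exact congrArg (· + _) (map_avg (WithLp.fstₗ 2 ℝ (Vec m) (Vec n)) z)

theorem snd_avg_add (z : Fin J → Blocks m n) (w : Blocks m n) :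
    (avg z + w).snd = avg (fun j => (z j).snd) + w.snd := by
  rw [WithLp.add_snd]
  exact congrArg (· + _) (map_avg (WithLp.sndₗ 2 ℝ (Vec m) (Vec n)) z)

end AsyncBlock

/-! ### Staleness errors along a run. -/

namespace AsyncBlock

variable {J m n : ℕ}

/-- The standing assumptions on the local functions and the common term. -/
structure Regular (f : Fin J → Blocks m n → ℝ) (h : Blocks m n → ℝ) (Lj : Fin J → ℝ)
    (Lh μ : ℝ) : Prop where
  contDiff_local : ∀ j, ContDiff ℝ 2 (f j)
  contDiff_common : ContDiff ℝ 2 h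
  lip_local : ∀ j, GradLipschitz (f j) (Lj j)
  lip_common : GradLipschitz h Lh
  nonneg_local : ∀ j, 0 ≤ Lj j
  nonneg_common : 0 ≤ Lh
  workers_ne : J ≠ 0
  mu_pos : 0 < μ
  hessianGE : HessianGE (objective f h) μ

namespace Regular

variable {f : Fin J → Blocks m n → ℝ} {h : Blocks m n → ℝ} {Lj : Fin J → ℝ} {Lh μ lam : ℝ}
  (R : Regular f h Lj Lh μ)
include R

theorem differentiable_local (j : Fin J) : Differentiable ℝ (f j) :=
  (R.contDiff_local j).differentiable (by norm_num)

theorem differentiable_common : Differentiable ℝ h :=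
  R.contDiff_common.differentiable (by norm_num)

theorem contDiff : ContDiff ℝ 2 (objective f h) :=
  contDiff_objective (k := 2) R.contDiff_local R.contDiff_common

theorem gradLipschitz : GradLipschitz (objective f h) (lamBar Lj Lh) :=
  gradLipschitz_objective R.differentiable_local R.differentiable_common R.lip_local R.lip_common

theorem lamBar_nonneg : 0 ≤ lamBar Lj Lh :=
  add_nonneg (avg_nonneg R.nonneg_local) R.nonneg_common

theorem lamBar_sq_le : lamBar Lj Lh ^ 2 ≤ 2 * (Lmsq Lj + Lh ^ 2) := by
  have := sq_avg_le R.workers_ne Lj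
  rw [lamBar, Lmsq]
  nlinarith [sq_nonneg (avg Lj - Lh)]

theorem staleGrad_eq {τ₂₁ τ₂₂ : ℕ → Fin J → ℕ} {x₁ : ℕ → Vec m} {x₂ : ℕ → Vec n} (t : ℕ) :
    staleGrad f h τ₂₁ τ₂₂ x₁ x₂ t =
      (avg (fun j => gradient (f j) (pt (x₁ (t + 1 - τ₂₁ t j)) (x₂ (t - τ₂₂ t j))))
        + gradient h (pt (x₁ (t + 1)) (x₂ t))).snd := by
  rw [snd_avg_add, staleGrad, grad₂_eq R.differentiable_common]
  simp only [grad₂_eq (R.differentiable_local _)]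

theorem norm_staleGrad_le {τ₂₁ τ₂₂ : ℕ → Fin J → ℕ} {x₁ : ℕ → Vec m} {x₂ : ℕ → Vec n} {t : ℕ}
    {xs : Blocks m n} (hmin : ∀ y, objective f h xs ≤ objective f h y) {r : ℝ}
    (hz : ∀ j, ‖pt (x₁ (t + 1 - τ₂₁ t j)) (x₂ (t - τ₂₂ t j)) - xs‖ ≤ r)
    (hw : ‖pt (x₁ (t + 1)) (x₂ t) - xs‖ ≤ r) :
    ‖staleGrad f h τ₂₁ τ₂₂ x₁ x₂ t‖ ≤ lamBar Lj Lh * r := by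
  have h0 := gradient_eq_zero_of_min hmin
  rw [gradient_objective R.differentiable_local R.differentiable_common] at h0
  have h1 := norm_avg_gradient_sub_le R.lip_local R.lip_common
    (fun j => pt (x₁ (t + 1 - τ₂₁ t j)) (x₂ (t - τ₂₂ t j))) (fun _ => xs)
    (pt (x₁ (t + 1)) (x₂ t)) xs
  rw [h0, sub_zero] at h1
  rw [R.staleGrad_eq, lamBar, add_mul, ← avg_mul_const]
  refine (norm_snd_le _).trans (h1.trans (add_le_add (avg_mono fun j => ?_) ?_))
  · exact mul_le_mul_of_nonneg_left (hz j) (R.nonneg_local j)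
  · exact mul_le_mul_of_nonneg_left hw R.nonneg_common

theorem norm_step_le {τ₁ τ₂₁ τ₂₂ : ℕ → Fin J → ℕ} {α : ℕ → ℝ} {x₁ : ℕ → Vec m} {x₂ : ℕ → Vec n}
    (hrun : IsRun lam f h τ₁ τ₂₁ τ₂₂ α x₁ x₂) (hlam : 0 < lam) (hlb : lam ≤ lamBar Lj Lh)
    {xs : Blocks m n} (hmin : ∀ y, objective f h xs ≤ objective f h y) {M : ℝ} {s τ : ℕ}
    (hα : 0 ≤ α s) (hτ : ∀ j, τ₂₁ s j ≤ τ ∧ τ₂₂ s j ≤ τ)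
    (hM : ∀ r, s - τ ≤ r → r ≤ s + 1 →
      objective f h (pt (x₁ r) (x₂ r)) - objective f h xs ≤ M) :
    ‖x₂ (s + 1) - x₂ s‖ ≤ α s * (lam⁻¹ * (lamBar Lj Lh * √(4 * M / μ))) := by
  have hx : ∀ r, s - τ ≤ r → r ≤ s + 1 → ‖pt (x₁ r) (x₂ r) - xs‖ ^ 2 ≤ 2 / μ * M :=
    fun r h1 h2 => (norm_sub_min_sq_le R.contDiff R.mu_pos R.hessianGE hmin _).trans
      (mul_le_mul_of_nonneg_left (hM r h1 h2) (div_nonneg zero_le_two R.mu_pos.le))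
  -- The two blocks may come from different iterations; each contributes its own 2M/μ, whence the 4.
  have hp : ∀ a b, s - τ ≤ a → a ≤ s + 1 → s - τ ≤ b → b ≤ s + 1 →
      ‖pt (x₁ a) (x₂ b) - xs‖ ≤ √(4 * M / μ) := by
    intro a b ha ha' hb hb'
    refine Real.le_sqrt_of_sq_le ?_
    rw [norm_sq_eq_blocks, WithLp.sub_fst, WithLp.sub_snd, pt_fst, pt_snd]
    have h1 := (pow_le_pow_left₀ (norm_nonneg _) (norm_fst_le (pt (x₁ a) (x₂ a) - xs)) 2).trans
      (hx a ha ha')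
    have h2 := (pow_le_pow_left₀ (norm_nonneg _) (norm_snd_le (pt (x₁ b) (x₂ b) - xs)) 2).trans
      (hx b hb hb')
    rw [WithLp.sub_fst, pt_fst] at h1
    rw [WithLp.sub_snd, pt_snd] at h2
    calc _ ≤ 2 / μ * M + 2 / μ * M := add_le_add h1 h2
      _ = 4 * M / μ := by ring
  have hg := R.norm_staleGrad_le (τ₂₁ := τ₂₁) (τ₂₂ := τ₂₂) hmin
    (fun j => hp (s + 1 - τ₂₁ s j) (s - τ₂₂ s j) (by have := hτ j; omega) (by omega)
      (by have := hτ j; omega) (by omega)) (hp (s + 1) s (by omega) le_rfl (by omega) (by omega))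
  have hP := (modHess_inv_bounds hlam hlb
    (isSelfAdjoint_avg_hess₂ R.contDiff_local R.contDiff_common
      (fun j => x₁ (s + 1 - τ₂₁ s j)) (fun j => x₂ (s - τ₂₂ s j)) (x₁ (s + 1)) (x₂ s))
    (norm_avg_hess₂_le R.differentiable_local R.differentiable_common R.nonneg_local
      R.nonneg_common R.lip_local R.lip_common _ _ _ _) rfl).2.2.2
  have hn := norm_le_of_norm_sq_le_inner (inv_nonneg.mpr hlam.le) hP
    (staleGrad f h τ₂₁ τ₂₂ x₁ x₂ s)
  rw [hrun.update₂ s, sub_sub_cancel_left, norm_neg, norm_smul, Real.norm_eq_abs, abs_of_nonneg hα]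
  refine mul_le_mul_of_nonneg_left (hn.trans ?_) hα
  exact mul_le_mul_of_nonneg_left hg (inv_nonneg.mpr hlam.le)

theorem norm_fst_gradient_sq_le {τ₁ τ₂₁ τ₂₂ : ℕ → Fin J → ℕ} {α : ℕ → ℝ} {x₁ : ℕ → Vec m}
    {x₂ : ℕ → Vec n} (hrun : IsRun lam f h τ₁ τ₂₁ τ₂₂ α x₁ x₂) {D τbar : ℝ} {s τ : ℕ}
    (hD : ∀ j, ‖x₂ s - x₂ (s - τ₁ s j)‖ ≤ τ₁ s j * D) (h1 : ∀ j, τ₁ s j ≤ τ)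
    (h2 : avg (fun j => (τ₁ s j : ℝ)) ≤ τbar) :
    ‖(gradient (objective f h) (pt (x₁ (s + 1)) (x₂ s))).fst‖ ^ 2 ≤
      Lmsq Lj * (τ * τbar * D ^ 2) := by
  have h0 := fst_gradient_eq_zero_of_isMinOn R.workers_ne R.differentiable_local
    R.differentiable_common (hrun.update₁ s)
  have h3 := norm_avg_gradient_sub_le R.lip_local R.lip_common
    (fun _ => pt (x₁ (s + 1)) (x₂ s)) (fun j => pt (x₁ (s + 1)) (x₂ (s - τ₁ s j)))
    (pt (x₁ (s + 1)) (x₂ s)) (pt (x₁ (s + 1)) (x₂ s))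
  have h4 := (norm_fst_le _).trans h3
  rw [WithLp.sub_fst, fst_avg_add _ (gradient h (pt (x₁ (s + 1)) (x₂ s))),
    fst_avg_add _ (gradient h (pt (x₁ (s + 1)) (x₂ s))), h0, sub_zero, sub_self, norm_zero,
    mul_zero, add_zero, ← fst_avg_add] at h4
  rw [gradient_objective R.differentiable_local R.differentiable_common]
  have h5 : avg (fun j => Lj j * ‖pt (x₁ (s + 1)) (x₂ s) - pt (x₁ (s + 1)) (x₂ (s - τ₁ s j))‖) ≤
      avg (fun j => Lj j * (τ₁ s j * D)) := by
    refine avg_mono fun j => mul_le_mul_of_nonneg_left ?_ (R.nonneg_local j)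
    rw [pt_sub, sub_self, norm_pt_zero_left]
    exact hD j
  refine (pow_le_pow_left₀ (norm_nonneg _) (h4.trans h5) 2).trans ((sq_avg_mul_le _ _).trans ?_)
  refine mul_le_mul_of_nonneg_left ?_ (avg_nonneg fun j => sq_nonneg _)
  simp only [mul_pow]
  rw [avg_mul_const]
  exact mul_le_mul_of_nonneg_right (avg_sq_le_of_le h1 h2) (sq_nonneg D)

theorem norm_staleGrad_sub_sq_le {τ₂₁ τ₂₂ : ℕ → Fin J → ℕ} {x₁ : ℕ → Vec m} {x₂ : ℕ → Vec n}
    {D U τbar : ℝ} {t τ : ℕ} (h21 : ∀ j, τ₂₁ t j ≤ t)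
    (hD : ∀ k, k ≤ τ → k ≤ t → ‖x₂ t - x₂ (t - k)‖ ≤ k * D) (h22 : ∀ j, τ₂₂ t j ≤ t)
    (hU : ∀ k, k ≤ τ → k ≤ t →
      ‖(gradient (objective f h) (pt (x₁ (t - k + 1)) (x₂ (t - k)))).fst‖ ^ 2 ≤ U)
    (h1 : ∀ j, τ₂₁ t j ≤ τ ∧ τ₂₂ t j ≤ τ)
    (h2 : avg (fun j => (τ₂₁ t j : ℝ)) ≤ τbar ∧ avg (fun j => (τ₂₂ t j : ℝ)) ≤ τbar) :
    ‖staleGrad f h τ₂₁ τ₂₂ x₁ x₂ t -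
        (gradient (objective f h) (pt (x₁ (t + 1)) (x₂ t))).snd‖ ^ 2 ≤
      Lmsq Lj * (3 / μ ^ 2 * (2 * U + lamBar Lj Lh ^ 2 * (τ * τbar * D ^ 2))
        + τ * τbar * D ^ 2) := by
  have hμ := R.mu_pos
  -- `x₁ (t + 1 - k)` was computed at iteration `t - k`, where its residual `v` was small. Moving
  -- the second block from `x₂ (t - k)` to `x₂ t` changes the gradient by at most `lamBar * k * D`;
  -- strong convexity in the first block converts gradients into distance, and the 3 comes from
  -- squaring a sum of three terms.
  have hfst : ∀ j, ‖x₁ (t + 1 - τ₂₁ t j) - x₁ (t + 1)‖ ^ 2 ≤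
      3 / μ ^ 2 * (2 * U + lamBar Lj Lh ^ 2 * ((τ₂₁ t j : ℝ) ^ 2 * D ^ 2)) := by
    intro j
    set k := τ₂₁ t j
    have hk : t + 1 - k = t - k + 1 := by have := h21 j; omega
    rw [hk]
    have hm := strongConvex_norm_fst_gradient_sub R.contDiff R.hessianGE (x₁ (t - k + 1))
      (x₁ (t + 1)) (x₂ t)
    set g₁ := (gradient (objective f h) (pt (x₁ (t - k + 1)) (x₂ t))).fst
    have hu := hU 0 (Nat.zero_le _) (Nat.zero_le _)
    simp only [Nat.sub_zero] at hu
    have hv := hU k (h1 j).1 (h21 j)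
    set u := (gradient (objective f h) (pt (x₁ (t + 1)) (x₂ t))).fst
    set v := (gradient (objective f h) (pt (x₁ (t - k + 1)) (x₂ (t - k)))).fst with hvdef
    have hl : ‖g₁ - v‖ ≤ lamBar Lj Lh * (k * D) := by
      rw [hvdef, ← WithLp.sub_fst]
      refine (norm_fst_le _).trans ((R.gradLipschitz _ _).trans ?_)
      rw [pt_sub, sub_self, norm_pt_zero_left]
      exact mul_le_mul_of_nonneg_left (hD k (h1 j).1 (h21 j)) R.lamBar_nonneg
    have htri : ‖g₁ - u‖ ≤ ‖g₁ - v‖ + ‖v‖ + ‖u‖ := by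
      calc ‖g₁ - u‖ = ‖(g₁ - v) + v - u‖ := by rw [sub_add_cancel]
        _ ≤ _ := (norm_sub_le _ _).trans (by gcongr; exact norm_add_le _ _)
    have hl2 := pow_le_pow_left₀ (norm_nonneg _) hl 2
    have hall := pow_le_pow_left₀ (mul_nonneg hμ.le (norm_nonneg _)) (hm.trans htri) 2
    have h3 : (‖g₁ - v‖ + ‖v‖ + ‖u‖) ^ 2 ≤ 3 * (‖g₁ - v‖ ^ 2 + ‖v‖ ^ 2 + ‖u‖ ^ 2) := by
      nlinarith [sq_nonneg (‖g₁ - v‖ - ‖v‖), sq_nonneg (‖g₁ - v‖ - ‖u‖),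
        sq_nonneg (‖v‖ - ‖u‖)]
    rw [div_mul_eq_mul_div, le_div_iff₀ (by positivity)]
    simp only [mul_pow] at hl2 hall
    linarith
  have hz : ∀ j, ‖pt (x₁ (t + 1 - τ₂₁ t j)) (x₂ (t - τ₂₂ t j)) - pt (x₁ (t + 1)) (x₂ t)‖ ^ 2 ≤
      3 / μ ^ 2 * (2 * U) + (τ₂₁ t j : ℝ) ^ 2 * (3 / μ ^ 2 * lamBar Lj Lh ^ 2 * D ^ 2)
        + (τ₂₂ t j : ℝ) ^ 2 * D ^ 2 := by
    intro j
    rw [pt_sub, norm_sq_eq_blocks, pt_fst, pt_snd]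
    have h3 := pow_le_pow_left₀ (norm_nonneg _) (hD _ (h1 j).2 (h22 j)) 2
    rw [norm_sub_rev, mul_pow] at h3
    linarith [hfst j]
  have h3 := norm_avg_gradient_sub_le R.lip_local R.lip_common
    (fun j => pt (x₁ (t + 1 - τ₂₁ t j)) (x₂ (t - τ₂₂ t j))) (fun _ => pt (x₁ (t + 1)) (x₂ t))
    (pt (x₁ (t + 1)) (x₂ t)) (pt (x₁ (t + 1)) (x₂ t))
  rw [sub_self, norm_zero, mul_zero, add_zero] at h3
  rw [R.staleGrad_eq, gradient_objective R.differentiable_local R.differentiable_common,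
    ← WithLp.sub_snd]
  refine (pow_le_pow_left₀ (norm_nonneg _) ((norm_snd_le _).trans h3) 2).trans
    ((sq_avg_mul_le _ _).trans (mul_le_mul_of_nonneg_left ?_ (avg_nonneg fun j => sq_nonneg _)))
  refine (avg_mono hz).trans ?_
  rw [avg_add (fun j => 3 / μ ^ 2 * (2 * U) +
      (τ₂₁ t j : ℝ) ^ 2 * (3 / μ ^ 2 * lamBar Lj Lh ^ 2 * D ^ 2)),
    avg_add (fun _ => 3 / μ ^ 2 * (2 * U)), avg_const R.workers_ne, avg_mul_const, avg_mul_const]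
  have h4 := mul_le_mul_of_nonneg_right (avg_sq_le_of_le (fun j => (h1 j).1) h2.1)
    (show 0 ≤ 3 / μ ^ 2 * lamBar Lj Lh ^ 2 * D ^ 2 by positivity)
  have h5 := mul_le_mul_of_nonneg_right (avg_sq_le_of_le (fun j => (h1 j).2) h2.2) (sq_nonneg D)
  linarith

end Regular

end AsyncBlock

/-! ### Scalar recursions and the constants. -/

namespace AsyncBlock

variable {J m n : ℕ}

/-- With s² = c₁c₀ the hypothesis reads a·s ≤ c₀ - a·c₂, so c₁c₀a² = (a·s)² ≤ (c₀ - a·c₂)c₀; then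
divide by c₀. -/
theorem quadratic_budget {c₀ c₁ c₂ a : ℝ} (h0 : 0 ≤ c₀) (h1 : 0 ≤ c₁) (h2 : 0 < c₂) (ha : 0 ≤ a)
    (hle : a ≤ c₀ * (c₂ + √(c₁ * c₀))⁻¹) : c₁ * a ^ 2 + c₂ * a ≤ c₀ := by
  set s := √(c₁ * c₀)
  have hs : s ^ 2 = c₁ * c₀ := Real.sq_sqrt (mul_nonneg h1 h0)
  have hs0 : 0 ≤ s := Real.sqrt_nonneg _
  have hp : 0 < c₂ + s := by positivity
  have h3 : a * (c₂ + s) ≤ c₀ := by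
    rwa [← div_eq_mul_inv, le_div_iff₀ hp] at hle
  rcases h0.eq_or_lt with h | h
  · have : a = 0 := by
      rw [← h] at h3
      exact le_antisymm (by nlinarith) ha
    simp [this, h0]
  · have h4 : (a * s) ^ 2 ≤ (c₀ - a * c₂) * c₀ := by
      have h5 : a * s ≤ c₀ - a * c₂ := by linarith
      have h6 : a * s ≤ c₀ := by nlinarith
      have : 0 ≤ a * s := by positivity
      nlinarith
    rw [mul_pow, hs] at h4
    refine le_of_mul_le_mul_right ?_ h
    linarith

theorem rate_inequality {A₁ β p ε δ : ℝ} {q τ : ℕ} (hA : 3 ≤ A₁) (hβ0 : 0 < β) (hβ1 : β < 1)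
    (hp : (τ : ℝ) + 1 ≤ p) (hq : q ≤ 3 * τ) (hδ : δ = β / A₁ / p)
    (hε : ε = (1 - β) * β / (A₁ + 8 * β ^ 2) / p) :
    0 ≤ 1 - ε ∧ δ ≤ 1 ∧ (1 - δ) * (1 - ε) ^ q + β * δ ≤ (1 - ε) ^ (q + 1) := by
  have hτ : (0 : ℝ) ≤ τ := Nat.cast_nonneg _
  have hp1 : 1 ≤ p := by linarith
  have hp0 : 0 < p := by linarith
  set B := A₁ + 8 * β ^ 2 with hB
  have hB3 : 3 ≤ B := by nlinarith [sq_nonneg β]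
  have hB0 : 0 < B := by linarith
  have hA0 : 0 < A₁ := by linarith
  have hb : 0 ≤ (1 - β) * β := mul_nonneg (by linarith) hβ0.le
  have hb1 : (1 - β) * β ≤ 1 := by nlinarith
  have hε0 : 0 ≤ ε := by rw [hε]; positivity
  have hεp : ε * p = (1 - β) * β / B := by rw [hε]; field_simp
  have hε1 : ε ≤ 1 := by
    rw [hε, div_div, div_le_one (by positivity)]
    nlinarith
  have hδ0 : 0 ≤ δ := by rw [hδ]; positivity
  have hδ1 : δ ≤ 1 := by
    rw [hδ, div_div, div_le_one (by positivity)]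
    nlinarith
  -- Bernoulli's inequality, with q ≤ 3τ ≤ 3p.
  have hpow : 1 - 3 * ((1 - β) * β / B) ≤ (1 - ε) ^ q := by
    have h1 := one_add_mul_le_pow (a := -ε) (by linarith) q
    rw [← sub_eq_add_neg] at h1
    refine le_trans ?_ h1
    have h2 : (q : ℝ) ≤ 3 * p := by
      have : (q : ℝ) ≤ 3 * τ := by exact_mod_cast hq
      linarith
    have := mul_le_mul_of_nonneg_right h2 hε0
    linarith
  have hsub : δ - ε = δ * ((B - (1 - β) * A₁) / B) := by
    rw [hδ, hε]; field_simp
  have hnum : 0 ≤ B - (1 - β) * A₁ := by nlinarith [sq_nonneg β]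
  -- With x = (1 - β)β/B and B = A₁ + 8β², this is (1 + 8x)(1 - 3x) ≥ 1 after division by β. The 8
  -- in the rate outweighs the 3 from the window length because x is small when A₁ ≥ 3.
  have hkey : β ≤ (B - (1 - β) * A₁) / B * (1 - 3 * ((1 - β) * β / B)) := by
    have h1 : (B - (1 - β) * A₁) / B * (1 - 3 * ((1 - β) * β / B)) - β =
        (1 - β) * β * β * (5 * A₁ + 64 * β ^ 2 - 24 * β) / B ^ 2 := by
      rw [hB] at hB0 ⊢
      field_simp
      ring
    have h2 : 0 ≤ 5 * A₁ + 64 * β ^ 2 - 24 * β := by nlinarith [sq_nonneg (8 * β - 3 / 2)]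
    have : 0 ≤ (1 - β) * β * β * (5 * A₁ + 64 * β ^ 2 - 24 * β) / B ^ 2 := by positivity
    linarith
  refine ⟨by linarith, hδ1, ?_⟩
  have h1 : δ * β ≤ (δ - ε) * (1 - ε) ^ q := by
    rw [hsub, mul_assoc]
    refine mul_le_mul_of_nonneg_left (hkey.trans ?_) hδ0
    exact mul_le_mul_of_nonneg_left hpow (by positivity)
  rw [pow_succ]
  linarith

theorem delayed_contraction {V : ℕ → ℝ} {δ β ε : ℝ} {N : ℕ} (hV : ∀ t, 0 ≤ V t)
    (hδ1 : δ ≤ 1) (hε : 0 ≤ 1 - ε)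
    (hε1 : ∀ q ≤ N, (1 - δ) * (1 - ε) ^ q + β * δ ≤ (1 - ε) ^ (q + 1)) (hε0 : 0 ≤ ε)
    (hstep : ∀ t M, (∀ s, t - N ≤ s → s ≤ t → V s ≤ M) → V (t + 1) ≤ (1 - δ) * V t + β * δ * M)
    (t : ℕ) : V t ≤ (1 - ε) ^ t * V 0 := by
  induction t using Nat.strong_induction_on with
  | _ t ih =>
    rcases t with _ | t
    · simp
    -- By the induction hypothesis the bound at the oldest index of the window dominates the whole
    -- window. For `t < N` the window is cut at 0, hence the need for every `q ≤ N`.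
    · have h1 := hstep t ((1 - ε) ^ (t - N) * V 0) fun s hs hst =>
        (ih s (by omega)).trans (mul_le_mul_of_nonneg_right
          (pow_le_pow_of_le_one hε (by linarith) hs) (hV 0))
      have h2 := mul_le_mul_of_nonneg_left (ih t (by omega)) (sub_nonneg.mpr hδ1)
      have h3 : t - N + (t - (t - N)) = t := by omega
      have h4 := mul_le_mul_of_nonneg_left (hε1 (t - (t - N)) (by omega))
        (mul_nonneg (pow_nonneg hε (t - N)) (hV 0))
      have h5 : (1 - ε) ^ t = (1 - ε) ^ (t - N) * (1 - ε) ^ (t - (t - N)) := by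
        rw [← pow_add, h3]
      rw [pow_succ] at h4
      rw [pow_succ, h5]
      rw [h5] at h2
      linarith

section Constants

variable {Lj : Fin J → ℝ} {Lh L μ lam : ℝ}

theorem C₀_pos (hL : 0 < L) (hμ : 0 < μ) (hb : 0 < lamBar Lj Lh) : 0 < C₀ Lj Lh L μ := by
  unfold C₀; positivity

theorem C₀_le_div (hμ : 0 < μ) :
    C₀ Lj Lh L μ ≤ μ / lamBar Lj Lh / 3 := by
  have h : C₀ Lj Lh L μ ≤ μ * (1 / 3 * (lamBar Lj Lh)⁻¹) :=
    mul_le_mul_of_nonneg_left (min_le_right _ _) hμ.le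
  refine h.trans_eq ?_
  ring

theorem Lmsq_nonneg : 0 ≤ Lmsq Lj := avg_nonneg fun _ => sq_nonneg _

theorem Lmsq_pos (hLj : ∃ j, 0 < Lj j) : 0 < Lmsq Lj := by
  obtain ⟨j, hj⟩ := hLj
  have hJ : 0 < J := j.pos
  refine smul_pos (by positivity) ?_
  exact Finset.sum_pos' (fun i _ => sq_nonneg _) ⟨j, Finset.mem_univ _, by positivity⟩

theorem C₁_nonneg (hμ : 0 < μ) (hlam : 0 < lam) : 0 ≤ C₁ Lj Lh μ lam := by
  have := Lmsq_nonneg (Lj := Lj)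
  unfold C₁; positivity

theorem C₂_pos (hLj : ∃ j, 0 < Lj j) (hL : 0 < L) (hμ : 0 < μ) (hlam : 0 < lam)
    (hb : 0 < lamBar Lj Lh) : 0 < C₂ Lj Lh L μ lam := by
  have := Lmsq_pos hLj
  unfold C₂; positivity

/-- The staleness errors, measured by the step bound `D`, are dominated by `C₁` and `C₂`. -/
theorem staleness_error_le (hL : 0 < L) (hμ : 0 < μ) (hμL : μ ≤ L) (hlam : 0 < lam)
    (hb : 0 < lamBar Lj Lh) (hsq : lamBar Lj Lh ^ 2 ≤ 2 * (Lmsq Lj + Lh ^ 2))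
    {α M S D : ℝ} (hα : 0 ≤ α) (hM : 0 ≤ M) (hS : 0 ≤ S)
    (hD : D = α * (lam⁻¹ * (lamBar Lj Lh * √(4 * M / μ)))) :
    Lmsq Lj * (S * D ^ 2) / (2 * μ) + α / (2 * lam) *
      (Lmsq Lj * (3 / μ ^ 2 * (2 * (Lmsq Lj * (S * D ^ 2)) + lamBar Lj Lh ^ 2 * (S * D ^ 2))
        + S * D ^ 2)) ≤ (C₁ Lj Lh μ lam * α ^ 3 + C₂ Lj Lh L μ lam * α ^ 2) * S * M := by
  have hQ := Lmsq_nonneg (Lj := Lj)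
  set Q := Lmsq Lj
  set W := Q + Lh ^ 2 with hW
  have hW0 : 0 ≤ W := by positivity
  have hD2 : D ^ 2 ≤ α ^ 2 * 8 * W * M / (lam ^ 2 * μ) := by
    rw [hD, mul_pow, mul_pow, mul_pow, Real.sq_sqrt (by positivity)]
    calc α ^ 2 * (lam⁻¹ ^ 2 * (lamBar Lj Lh ^ 2 * (4 * M / μ)))
        ≤ α ^ 2 * (lam⁻¹ ^ 2 * (2 * W * (4 * M / μ))) := by gcongr
      _ = _ := by field_simp; ring
  set b := lamBar Lj Lh with hbdef
  have hbsum : b ^ 2 = (Lh + avg Lj) ^ 2 := by rw [hbdef, lamBar, add_comm]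
  have hK : 1 + 3 / μ ^ 2 * (2 * Q + b ^ 2) ≤ 1 + 6 * (μ ^ 2)⁻¹ * (2 * Q + (Lh + avg Lj) ^ 2) := by
    rw [← hbsum, div_eq_mul_inv]
    gcongr
    norm_num
  -- The residual term needs less than `C₂` offers; the surplus factor is at least 1 since `μ ≤ L`.
  have hkap : 1 ≤ (L * b⁻¹ + 1) * (L / μ) := by
    have h1 : 1 ≤ L / μ := (one_le_div hμ).mpr hμL
    have h2 : 0 ≤ L * b⁻¹ := by positivity
    nlinarith
  have e1 : Q * (S * D ^ 2) / (2 * μ) ≤ C₂ Lj Lh L μ lam * α ^ 2 * S * M := by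
    calc Q * (S * D ^ 2) / (2 * μ)
        ≤ Q * (S * (α ^ 2 * 8 * W * M / (lam ^ 2 * μ))) / (2 * μ) := by gcongr
      _ = 1 * (4 * Q * W * α ^ 2 * S * M / (lam ^ 2 * μ ^ 2)) := by field_simp; ring
      _ ≤ (L * b⁻¹ + 1) * (L / μ) * (4 * Q * W * α ^ 2 * S * M / (lam ^ 2 * μ ^ 2)) := by
          gcongr
      _ = 4 * (L * b⁻¹ + 1) * (lam ^ 2)⁻¹ * (μ ^ 3)⁻¹ * L * Q * W * α ^ 2 * S * M := by
          field_simp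
  have e2 : α / (2 * lam) * (Q * (3 / μ ^ 2 * (2 * (Q * (S * D ^ 2)) + b ^ 2 * (S * D ^ 2))
        + S * D ^ 2)) ≤ C₁ Lj Lh μ lam * α ^ 3 * S * M := by
    calc α / (2 * lam) * (Q * (3 / μ ^ 2 * (2 * (Q * (S * D ^ 2)) + b ^ 2 * (S * D ^ 2))
        + S * D ^ 2)) = α / (2 * lam) * (Q * ((1 + 3 / μ ^ 2 * (2 * Q + b ^ 2)) * (S * D ^ 2))) := by
          ring
      _ ≤ α / (2 * lam) * (Q * ((1 + 6 * (μ ^ 2)⁻¹ * (2 * Q + (Lh + avg Lj) ^ 2)) *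
          (S * (α ^ 2 * 8 * W * M / (lam ^ 2 * μ))))) := by gcongr
      _ = _ := by rw [C₁]; field_simp; ring
  linarith

end Constants

end AsyncBlock

/-! ### The delayed recursion for the gap, and the theorem. -/

namespace AsyncBlock

variable {J m n : ℕ}

/-- One iteration decreases the gap up to a multiple of its recent maximum. -/
theorem Regular.gap_step {f : Fin J → Blocks m n → ℝ} {h : Blocks m n → ℝ} {Lj : Fin J → ℝ}
    {Lh L μ lam : ℝ} (R : Regular f h Lj Lh μ) (hL : GradLipschitz (objective f h) L)
    (hμL : μ ≤ L) (hμb : μ ≤ lamBar Lj Lh) (hlam : 0 < lam) (hlb : lam ≤ lamBar Lj Lh)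
    {τ₁ τ₂₁ τ₂₂ : ℕ → Fin J → ℕ} {τ : ℕ} {τbar : ℝ} (hτ : StalenessBound τ₁ τ₂₁ τ₂₂ τ τbar)
    (hτbar : 0 ≤ τbar) {α : ℕ → ℝ} {a : ℝ} (hα : ∀ t, α t = a) (ha : 0 ≤ a) (haL : a * L ≤ lam)
    {x₁ : ℕ → Vec m} {x₂ : ℕ → Vec n} (hrun : IsRun lam f h τ₁ τ₂₁ τ₂₂ α x₁ x₂)
    {xs : Blocks m n} (hmin : ∀ y, objective f h xs ≤ objective f h y) {t : ℕ} {M : ℝ}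
    (hM : ∀ s, t - 3 * τ ≤ s → s ≤ t →
      objective f h (pt (x₁ s) (x₂ s)) - objective f h xs ≤ M) :
    objective f h (pt (x₁ (t + 1)) (x₂ (t + 1))) - objective f h xs ≤
      (1 - a * μ / lamBar Lj Lh) * (objective f h (pt (x₁ t) (x₂ t)) - objective f h xs) +
        (C₁ Lj Lh μ lam * a ^ 3 + C₂ Lj Lh L μ lam * a ^ 2) * (τ * τbar) * M := by
  have hμ := R.mu_pos
  have hb : 0 < lamBar Lj Lh := hμ.trans_le hμb
  have hL0 : 0 < L := hμ.trans_le hμL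
  have hM0 : 0 ≤ M := (sub_nonneg.mpr (hmin _)).trans (hM t (Nat.sub_le _ _) le_rfl)
  obtain ⟨D, hDdef⟩ : ∃ D, D = a * (lam⁻¹ * (lamBar Lj Lh * √(4 * M / μ))) := ⟨_, rfl⟩
  -- The window 3τ is three delays in a row: a stale `x₁` dates from up to τ iterations back, its
  -- minimization read `x₂` up to τ earlier, and the `x₂` steps in that range used data up to τ
  -- older still.
  have hD : ∀ s, t - 2 * τ ≤ s → s < t → ‖x₂ (s + 1) - x₂ s‖ ≤ D := by
    intro s hs hst
    rw [hDdef, ← hα s]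
    refine R.norm_step_le hrun hlam hlb hmin (by rw [hα]; exact ha)
      (fun j => ⟨(hτ.1 s j).2.1, (hτ.1 s j).2.2⟩) fun r hr hr' => hM r (by omega) (by omega)
  have hdist : ∀ c ≤ t, ∀ k ≤ c, t - 2 * τ ≤ c - k → ‖x₂ c - x₂ (c - k)‖ ≤ k * D :=
    fun c hc k hk hck => norm_sub_le_of_step_le (a := t - 2 * τ) (x := x₂)
      (fun s hs hs' => hD s hs (by omega)) k hk hck
  have hU : ∀ k, k ≤ τ → k ≤ t →
      ‖(gradient (objective f h) (pt (x₁ (t - k + 1)) (x₂ (t - k)))).fst‖ ^ 2 ≤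
        Lmsq Lj * (τ * τbar * D ^ 2) := by
    intro k hk hkt
    refine R.norm_fst_gradient_sq_le hrun (fun j => hdist _ (by omega) _ (hrun.stale₁_le _ j) ?_)
      (fun j => (hτ.1 _ j).1) (hτ.2 _).1
    have := (hτ.1 (t - k) j).1
    omega
  have hE := R.norm_staleGrad_sub_sq_le (hrun.stale₂₁_le t)
    (fun k hk hkt => hdist t le_rfl k hkt (by omega)) (hrun.stale₂₂_le t) hU
    (fun j => ⟨(hτ.1 t j).2.1, (hτ.1 t j).2.2⟩) ⟨(hτ.2 t).2.1, (hτ.2 t).2.2⟩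
  obtain ⟨hsym, hlow, hup, hsq⟩ := modHess_inv_bounds hlam hlb
    (isSelfAdjoint_avg_hess₂ R.contDiff_local R.contDiff_common
      (fun j => x₁ (t + 1 - τ₂₁ t j)) (fun j => x₂ (t - τ₂₂ t j)) (x₁ (t + 1)) (x₂ t))
    (norm_avg_hess₂_le R.differentiable_local R.differentiable_common R.nonneg_local
      R.nonneg_common R.lip_local R.lip_common _ _ _ _) rfl
  have hstep := inexact_block_step R.contDiff hL0.le hL hμ R.hessianGE (xs := xs) hlam hb ha haL
    (by nlinarith) hsym hlow hup hsq (x₁ t) (x₁ (t + 1)) (x₂ t) (staleGrad f h τ₂₁ τ₂₂ x₁ x₂ t)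
  have hx : x₂ (t + 1) = _ := hrun.update₂ t
  rw [hα, staleHess] at hx
  rw [hx]
  have hU0 := hU 0 (Nat.zero_le _) (Nat.zero_le _)
  simp only [Nat.sub_zero] at hU0
  have herr := staleness_error_le (S := τ * τbar) hL0 hμ hμL hlam hb R.lamBar_sq_le ha hM0
    (by positivity) hDdef
  have h1 : ‖(gradient (objective f h) (pt (x₁ (t + 1)) (x₂ t))).fst‖ ^ 2 / (2 * μ) ≤
      Lmsq Lj * (τ * τbar * D ^ 2) / (2 * μ) := by gcongr
  have h2 := mul_le_mul_of_nonneg_left hE (show 0 ≤ a / (2 * lam) by positivity)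
  linarith

theorem step_size_budget {c₀ c₁ c₂ A β p S a : ℝ} (h1 : 0 ≤ c₁) (h2 : 0 ≤ c₂)
    (hA : 0 ≤ A) (hbud : c₁ * A ^ 2 + c₂ * A ≤ c₀) (hβ0 : 0 ≤ β) (hβ1 : β ≤ 1) (hp : 1 ≤ p)
    (hS0 : 0 ≤ S) (hSp : S ≤ p) (ha : a * p = β * A) (ha0 : 0 ≤ a) :
    (c₁ * a ^ 3 + c₂ * a ^ 2) * S ≤ β * (c₀ * a) := by
  have hS : a * S ≤ β * A := ha ▸ mul_le_mul_of_nonneg_left hSp ha0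
  have haA : a ≤ A := by nlinarith
  calc (c₁ * a ^ 3 + c₂ * a ^ 2) * S = a * ((c₁ * a + c₂) * (a * S)) := by ring
    _ ≤ a * ((c₁ * A + c₂) * (β * A)) := by gcongr
    _ = β * ((c₁ * A ^ 2 + c₂ * A) * a) := by ring
    _ ≤ β * (c₀ * a) := by gcongr

end AsyncBlock

theorem theorem1 {J m n : ℕ}
    (f : Fin J → AsyncBlock.Blocks m n → ℝ) (h : AsyncBlock.Blocks m n → ℝ)
    (Lj : Fin J → ℝ) (Lh L μ lam : ℝ)
    -- gradient-Lipschitz assumption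
    (hf : ∀ j, ContDiff ℝ 2 (f j)) (hh : ContDiff ℝ 2 h)
    (hfL : ∀ j, AsyncBlock.GradLipschitz (f j) (Lj j))
    (hhL : AsyncBlock.GradLipschitz h Lh)
    (hL : AsyncBlock.GradLipschitz (AsyncBlock.objective f h) L)
    (hLj : ∃ j, 0 < Lj j)
    -- strong convexity, and the eigenvalue threshold
    (hμ : 0 < μ) (hconv : AsyncBlock.HessianGE (AsyncBlock.objective f h) μ)
    (hlam : 0 < lam) (hlamμ : lam ≤ μ)
    -- bounded staleness
    (τ₁ τ₂₁ τ₂₂ : ℕ → Fin J → ℕ) (τ : ℕ) (τbar : ℝ)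
    (hτ : AsyncBlock.StalenessBound τ₁ τ₂₁ τ₂₂ τ τbar)
    -- step size
    (β : ℝ) (hβ₀ : 0 < β) (hβ₁ : β < 1) (α : ℕ → ℝ)
    (hα : ∀ t, α t = β * AsyncBlock.A₀ Lj Lh L μ lam * (τbar + 1)⁻¹ * ((τ : ℝ) + 1)⁻¹)
    -- a run of the algorithm
    (x₁ : ℕ → AsyncBlock.Vec m) (x₂ : ℕ → AsyncBlock.Vec n)
    (hrun : AsyncBlock.IsRun lam f h τ₁ τ₂₁ τ₂₂ α x₁ x₂) (t : ℕ) :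
    AsyncBlock.gap f h x₁ x₂ t ≤
      (1 - (1 - β) * β / (AsyncBlock.A₁ Lj Lh L μ lam + 8 * β ^ 2) *
        (τbar + 1)⁻¹ * ((τ : ℝ) + 1)⁻¹) ^ t * AsyncBlock.gap f h x₁ x₂ 0 := by
  open AsyncBlock in
  rcases subsingleton_or_nontrivial (Blocks m n) with hs | hs
  -- If both blocks have dimension 0, the gap vanishes. Otherwise a nonzero vector forces the
  -- Lipschitz constants to be nonnegative and gives `μ ≤ L` and `μ ≤ lamBar Lj Lh`.
  · have hgap : ∀ s, gap f h x₁ x₂ s = 0 := by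
      intro s
      have : ∀ x, objective f h x = objective f h (pt (x₁ s) (x₂ s)) :=
        fun x => congrArg _ (Subsingleton.elim _ _)
      rw [gap, iInf_congr this, ciInf_const, sub_self]
    rw [hgap, hgap, mul_zero]
  obtain ⟨v, hv⟩ := exists_ne (0 : Blocks m n)
  have hv0 : 0 < ‖v - 0‖ := by rw [sub_zero]; exact norm_pos_iff.mpr hv
  have hnonneg : ∀ {g : Blocks m n → ℝ} {c : ℝ}, GradLipschitz g c → 0 ≤ c := fun hg =>
    nonneg_of_mul_nonneg_left ((norm_nonneg _).trans (hg v 0)) hv0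
  have R : Regular f h Lj Lh μ :=
    ⟨hf, hh, hfL, hhL, fun j => hnonneg (hfL j), hnonneg hhL,
      (hLj.choose.pos).ne', hμ, hconv⟩
  have hμle : ∀ {c : ℝ}, GradLipschitz (objective f h) c → μ ≤ c := fun hc =>
    le_of_mul_le_mul_right ((strongConvex_norm_gradient_sub R.contDiff hconv v 0).trans (hc v 0))
      hv0
  have hμL : μ ≤ L := hμle hL
  have hμb : μ ≤ lamBar Lj Lh := hμle R.gradLipschitz
  have hL0 : 0 < L := hμ.trans_le hμL
  have hb : 0 < lamBar Lj Lh := hμ.trans_le hμb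
  obtain ⟨xs, hmin⟩ := strongConvex_exists_min R.contDiff hμ hconv
  have hinf : ⨅ x, objective f h x = objective f h xs :=
    le_antisymm (ciInf_le ⟨_, Set.forall_mem_range.mpr hmin⟩ xs) (le_ciInf hmin)
  have hτbar : 0 ≤ τbar := (avg_nonneg fun j => Nat.cast_nonneg (τ₁ 0 j)).trans (hτ.2 0).1
  have hτ0 : (0 : ℝ) ≤ τ := Nat.cast_nonneg τ
  have hC0 := C₀_pos (Lj := Lj) (Lh := Lh) hL0 hμ hb
  have hC0le := C₀_le_div (Lj := Lj) (Lh := Lh) (L := L) hμ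
  have hC1 := C₁_nonneg (Lj := Lj) (Lh := Lh) hμ hlam
  have hC2 := C₂_pos (Lh := Lh) hLj hL0 hμ hlam hb
  have hA0 : 0 < A₀ Lj Lh L μ lam := by
    unfold A₀
    have := Real.sqrt_nonneg (C₁ Lj Lh μ lam * C₀ Lj Lh L μ)
    positivity
  have hA0L : A₀ Lj Lh L μ lam ≤ lam / L := min_le_right _ _
  have hA0one : A₀ Lj Lh L μ lam ≤ 1 :=
    hA0L.trans ((div_le_one hL0).mpr (hlamμ.trans hμL))
  have hbud := quadratic_budget hC0.le hC1 hC2 hA0.le (min_le_left _ _)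
  -- Follows from `C₀ ≤ 1/3`, thanks to the 1/3 in the second entry of its minimum, and `A₀ ≤ lam /
  -- L ≤ 1`.
  have hA1 : 3 ≤ A₁ Lj Lh L μ lam := by
    have h1 : μ / lamBar Lj Lh ≤ 1 := (div_le_one hb).mpr hμb
    have h2 : C₀ Lj Lh L μ * A₀ Lj Lh L μ lam ≤ 1 / 3 := by nlinarith
    rw [A₁, ← mul_inv, le_inv_comm₀ (by norm_num) (by positivity)]
    linarith
  have hA1eq : A₁ Lj Lh L μ lam = (C₀ Lj Lh L μ * A₀ Lj Lh L μ lam)⁻¹ := by rw [A₁, mul_inv]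
  obtain ⟨p, hp⟩ : ∃ p, p = (τbar + 1) * ((τ : ℝ) + 1) := ⟨_, rfl⟩
  have hpτ : (τ : ℝ) + 1 ≤ p := by rw [hp]; nlinarith
  have hp1 : 1 ≤ p := by linarith
  have hp0 : 0 < p := by linarith
  obtain ⟨a, ha⟩ : ∃ a, a = β * A₀ Lj Lh L μ lam / p := ⟨_, rfl⟩
  have hαa : ∀ t, α t = a := fun t => by rw [hα, ha, hp, mul_assoc, ← mul_inv, div_eq_mul_inv]
  have hap : a * p = β * A₀ Lj Lh L μ lam := by rw [ha, div_mul_cancel₀ _ hp0.ne']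
  have ha0 : 0 ≤ a := by rw [ha]; positivity
  have haA : a ≤ A₀ Lj Lh L μ lam := by nlinarith
  have hδ : C₀ Lj Lh L μ * a = β / A₁ Lj Lh L μ lam / p := by
    rw [hA1eq, ha]
    field_simp
  have hrate := fun (q : ℕ) (hq : q ≤ 3 * τ) =>
    rate_inequality hA1 hβ₀ hβ₁ hpτ hq hδ rfl
  have hgap : ∀ s, gap f h x₁ x₂ s = objective f h (pt (x₁ s) (x₂ s)) - objective f h xs :=
    fun s => by rw [gap, hinf]
  rw [mul_assoc _ (τbar + 1)⁻¹, ← mul_inv, ← hp, ← div_eq_mul_inv]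
  refine delayed_contraction (N := 3 * τ) (fun s => ?_) (hrate 0 (Nat.zero_le _)).2.1
    (hrate 0 (Nat.zero_le _)).1 (fun q hq => (hrate q hq).2.2) ?_ (fun s M hM => ?_) t
  · rw [hgap]; exact sub_nonneg.mpr (hmin _)
  · have h1 : 0 ≤ 1 - β := by linarith
    positivity
  · have hV0 : 0 ≤ gap f h x₁ x₂ s := by rw [hgap]; exact sub_nonneg.mpr (hmin _)
    have hM0 : 0 ≤ M := hV0.trans (hM s (Nat.sub_le _ _) le_rfl)
    have haL : a * L ≤ lam := (le_div_iff₀ hL0).mp (haA.trans hA0L)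
    have hstep := R.gap_step hL hμL hμb hlam (hlamμ.trans hμb) hτ hτbar hαa ha0 haL
      hrun hmin (t := s) (M := M) (fun r h1 h2 => by
        rw [← hgap]; exact hM r h1 h2)
    rw [← hgap, ← hgap] at hstep
    have hsize := step_size_budget hC1 hC2.le hA0.le hbud hβ₀.le hβ₁.le hp1
      (S := τ * τbar) (by positivity) (by rw [hp]; nlinarith) hap ha0
    have h3 := mul_le_mul_of_nonneg_right hsize hM0
    have h4 : C₀ Lj Lh L μ * a ≤ a * μ / lamBar Lj Lh := by
      have h5 : C₀ Lj Lh L μ ≤ μ / lamBar Lj Lh := by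
        have : 0 ≤ μ / lamBar Lj Lh := by positivity
        linarith
      calc C₀ Lj Lh L μ * a ≤ μ / lamBar Lj Lh * a := by gcongr
        _ = a * μ / lamBar Lj Lh := by ring
    have h6 := mul_le_mul_of_nonneg_right h4 hV0
    linarith
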